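/- Let $p$ be an odd prime and let $K$ be a $p$-colorable classical knot, that is, a knot which has a diagram $D$ with a non-trivial Fox $p$-coloring: an assignment of elements of $\mathbb{Z}/p$ to the arcs of $D$, using at least two different elements, such that at every crossing the sum of the colors of the two under-arcs equals twice the color of the over-arc. Let $c(K)$ be the crossing number of $K$, the least number of crossings of a diagram of $K$. Then $$c(K)\ \ge\ \lfloor \log_2 p\rfloor + 2,$$ and equality $c(K)=\lfloor \log_2 p\rfloor+2$ holds if and only if either $p=3$ and $K$ is the (right- or left-handed) trefoil knot, or $p=5$ and $K$ is the figure-eight knot. (Knots are unoriented and are taken as knot diagrams on the sphere up to Reidemeister moves.) -/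

import Mathlib

/-! Classical knots, presented by planar signed Gauss codes modulo Reidemeister moves. -/

namespace KnotTheory

/-- One passage of the knot through a crossing: the label of the crossing, whether the passage is
the upper one (`upper = true`), and the sign of the crossing (`positive = true` for `+1`). -/
structure Letter where
  crossing : ℕ
  upper : Bool
  positive : Bool
  deriving DecidableEq

/-- The other passage through the same crossing. -/
def Letter.flip (l : Letter) : Letter := ⟨l.crossing, !l.upper, l.positive⟩

/-- Renaming of crossings. -/
def Letter.relabel (f : ℕ → ℕ) (l : Letter) : Letter := ⟨f l.crossing, l.upper, l.positive⟩

/-- `w` is a signed Gauss code: read cyclically, it lists the passages met when one travels once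
around an oriented knot diagram, so each crossing is met exactly twice, once over and once under,
both times with the same sign. The empty word is the code of the diagram without crossings. -/
def IsGaussCode (w : List Letter) : Prop :=
  w.Nodup ∧ (∀ l ∈ w, l.flip ∈ w) ∧
    ∀ l ∈ w, ∀ l' ∈ w, l.crossing = l'.crossing → l' = l ∨ l' = l.flip

/-- The directed edges of the diagram of `w`: `(l, true)` is the edge that leaves the passage `l`
along the orientation of the knot, `(l, false)` the one that leaves it against the orientation. -/
def darts (w : List Letter) : Finset (Letter × Bool) := w.toFinset ×ˢ Finset.univ

/-- Travel along the directed edge `d` to the passage `k` at its end and turn left there. As a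
crossing is positive exactly when the lower strand crosses the upper one from right to left, one
leaves `k.flip` along the orientation iff `k` was reached along the orientation and the other
strand crosses from right to left (as seen along the orientation at `k`), or neither holds. -/
def faceStep (w : List Letter) (d : Letter × Bool) : Letter × Bool :=
  let k := if d.2 then w.formPerm d.1 else w.formPerm.symm d.1
  (k.flip, d.2 == (k.upper == k.positive))

/-- The faces of the surface diagram of `w`, each given by the directed edges on its boundary. -/
def faces (w : List Letter) : Finset (Finset (Letter × Bool)) :=
  (darts w).image fun d => (Finset.range (darts w).card).image fun k => (faceStep w)^[k] d

/-- Number of crossings. -/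
def numCrossings (w : List Letter) : ℕ := (w.toFinset.image Letter.crossing).card

/-- The code `w` is realized by a diagram on the sphere: its surface has Euler characteristic
`V - E + F = 2`, where `E = 2 V`. -/
def IsPlanar (w : List Letter) : Prop :=
  w = [] ∨ (faces w).card = numCrossings w + 2

instance (w : List Letter) : Decidable (IsGaussCode w) := by
  unfold IsGaussCode; infer_instance

instance (w : List Letter) : Decidable (IsPlanar w) := by
  unfold IsPlanar; infer_instance

/-- A diagram of a classical knot (up to isotopy of the sphere, with a choice of orientation and
of a base point). -/
structure KnotDiagram where
  word : List Letter
  isGaussCode : IsGaussCode word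
  isPlanar : IsPlanar word

/-- The two-letter word with letters `x`, `y`, in this order iff `e = true`. -/
def pair (e : Bool) (x y : Letter) : List Letter := if e then [x, y] else [y, x]

/-- Changes of Gauss codes: names of crossings, base point, orientation, and the three
Reidemeister moves (up to the choice of a base point). -/
inductive Move : List Letter → List Letter → Prop
  | relabel (f : Equiv.Perm ℕ) (w : List Letter) : Move w (w.map (Letter.relabel f))
  | rotate (u v : List Letter) : Move (u ++ v) (v ++ u)
  | reverse (w : List Letter) : Move w w.reverse
  /-- First Reidemeister move: removal of a kink. -/
  | r1 (a : ℕ) (o s : Bool) (u : List Letter) :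
      Move ([⟨a, o, s⟩, ⟨a, !o, s⟩] ++ u) u
  /-- Second Reidemeister move: removal of a bigon whose upper edge runs from `a` to `b`; the
  lower edge runs from `a` to `b` if `e = true` and from `b` to `a` if `e = false`. -/
  | r2 (a b : ℕ) (s e : Bool) (u v : List Letter) :
      Move ([⟨a, true, s⟩, ⟨b, true, !s⟩] ++ u ++
          pair e ⟨a, false, s⟩ ⟨b, false, !s⟩ ++ v)
        (u ++ v)
  /-- Third Reidemeister move: the top strand meets the middle one at `a` and the bottom one at
  `b`, the middle strand meets the bottom one at `c`, and the order of the two crossings is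
  exchanged on each strand. The conditions on the signs `sa`, `sb`, `sc` and on the orders
  `t`, `m`, `q` of the crossings on the top, middle and bottom strand hold for three oriented
  lines in general position in the plane. Here the strands are met in the cyclic order top,
  middle, bottom. -/
  | r3 (a b c : ℕ) (sa sb sc t m q : Bool) (u v x : List Letter)
      (h₁ : (m == q) = (sa == sb)) (h₂ : (t == q) = (sa == sc)) :
      Move
        (pair t ⟨a, true, sa⟩ ⟨b, true, sb⟩ ++ u ++
          pair m ⟨a, false, sa⟩ ⟨c, true, sc⟩ ++ v ++
          pair q ⟨b, false, sb⟩ ⟨c, false, sc⟩ ++ x)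
        (pair (!t) ⟨a, true, sa⟩ ⟨b, true, sb⟩ ++ u ++
          pair (!m) ⟨a, false, sa⟩ ⟨c, true, sc⟩ ++ v ++
          pair (!q) ⟨b, false, sb⟩ ⟨c, false, sc⟩ ++ x)
  /-- The same move when the strands are met in the cyclic order top, bottom, middle. -/
  | r3' (a b c : ℕ) (sa sb sc t m q : Bool) (u v x : List Letter)
      (h₁ : (m == q) = (sa == sb)) (h₂ : (t == q) = (sa == sc)) :
      Move
        (pair t ⟨a, true, sa⟩ ⟨b, true, sb⟩ ++ u ++
          pair q ⟨b, false, sb⟩ ⟨c, false, sc⟩ ++ v ++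
          pair m ⟨a, false, sa⟩ ⟨c, true, sc⟩ ++ x)
        (pair (!t) ⟨a, true, sa⟩ ⟨b, true, sb⟩ ++ u ++
          pair (!q) ⟨b, false, sb⟩ ⟨c, false, sc⟩ ++ v ++
          pair (!m) ⟨a, false, sa⟩ ⟨c, true, sc⟩ ++ x)

/-- A classical (unoriented) knot type: knot diagrams on the sphere modulo the equivalence
relation generated by the Reidemeister moves. -/
def Knot : Type := Quot fun D D' : KnotDiagram => Move D.word D'.word

/-- The knot presented by a diagram. -/
def KnotDiagram.knot (D : KnotDiagram) : Knot := Quot.mk _ D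

/-- `col` is a Fox `m`-coloring of the diagram `D`; `col l` is the color of the arc on which the
edge lies that leaves the passage `l` along the orientation. The color does not change at an
overpassage, and at an underpassage the colors of the two under-arcs add up to twice the color of
the over-arc. -/
def KnotDiagram.IsColoring (D : KnotDiagram) (m : ℕ) (col : Letter → ZMod m) : Prop :=
  ∀ l ∈ D.word,
    let k := D.word.formPerm l
    if k.upper then col l = col k else col l + col k = 2 * col k.flip

/-- `D` has a Fox `m`-coloring with at least two colors. -/
def KnotDiagram.HasNontrivialColoring (D : KnotDiagram) (m : ℕ) : Prop :=
  ∃ col : Letter → ZMod m, D.IsColoring m col ∧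
    ∃ l ∈ D.word, ∃ l' ∈ D.word, col l ≠ col l'

/-- A knot is `m`-colorable if it has a diagram with a non-trivial `m`-coloring. -/
def Knot.IsColorable (K : Knot) (m : ℕ) : Prop :=
  ∃ D : KnotDiagram, D.knot = K ∧ D.HasNontrivialColoring m

/-- The crossing number of `K`: the least number of crossings of a diagram of `K`. -/
noncomputable def Knot.crossingNumber (K : Knot) : ℕ :=
  sInf {n | ∃ D : KnotDiagram, D.knot = K ∧ numCrossings D.word = n}

/-- The standard three-crossing diagram of the trefoil, alternating with all crossings of the
same sign: right-handed for `s = true` and left-handed for `s = false`. -/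
def trefoilWord (s : Bool) : List Letter :=
  [⟨1, true, s⟩, ⟨2, false, s⟩, ⟨3, true, s⟩, ⟨1, false, s⟩, ⟨2, true, s⟩, ⟨3, false, s⟩]

/-- The standard alternating four-crossing diagram of the figure-eight knot. -/
def figureEightWord : List Letter :=
  [⟨1, true, false⟩, ⟨2, false, true⟩, ⟨3, true, true⟩, ⟨1, false, false⟩,
    ⟨4, true, false⟩, ⟨3, false, true⟩, ⟨2, true, true⟩, ⟨4, false, false⟩]

set_option maxRecDepth 100000 in
theorem isPlanar_trefoilWord (s : Bool) : IsPlanar (trefoilWord s) := by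
  revert s; decide +kernel

set_option maxRecDepth 100000 in
theorem isPlanar_figureEightWord : IsPlanar figureEightWord := by decide +kernel

/-- The right-handed (`s = true`) and the left-handed (`s = false`) trefoil knot. -/
def trefoil (s : Bool) : Knot :=
  KnotDiagram.knot ⟨trefoilWord s, by revert s; decide, isPlanar_trefoilWord s⟩

/-- The figure-eight knot. -/
def figureEight : Knot :=
  KnotDiagram.knot ⟨figureEightWord, by decide, isPlanar_figureEightWord⟩

end KnotTheory

/-! Colorability is preserved by the Reidemeister moves (`Move.closedColoring_iff`), so it can be
tested on a diagram with the least number `n` of crossings. The core is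
`KnotDiagram.small_or_lt_two_pow`: a non-constant coloring forces `p < 2 ^ (n - 2)`, except possibly
on alternating diagrams with `n = 3`, `p = 3` or `n = 4`, `p ≤ 5`.

Non-alternating diagrams: some arc joins two consecutive underpassages and is the over-arc of no
crossing. Dropping it and the relations at its two ends leaves `n - 2` relations `a i + a (i + 1) =
2 * a (t i)` among `n - 1` arcs. After normalizing `a 0 = 0`, each row of the integer coefficient
matrix is a sum of two differences of unit vectors, so the determinant is a sum of `2 ^ (n - 2)`
network determinants, each `0` or `±1`. It is odd, hence nonzero, and divisible by `p`
(`chain_bound`).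

Alternating diagrams: a coloring yields a non-constant kernel vector modulo `p` of the Laplacian of
a checkerboard graph. This is where planarity enters: on the sphere the balanced flows of one
checkerboard graph are the potential differences of the other (`exists_potential`). So `p` divides
the positive number of spanning trees, and the AM-GM inequality for the Laplacian gives `V * p * (V
- 1) ^ (V - 1) ≤ (2 * n) ^ (V - 1)` (`card_mul_prime_mul_le`). Choosing the class with `2 * V ≤ n +
2`, elementary estimates leave only the exceptions above.

In the exceptional cases a finite search over colorings and crossing signs leaves only the trefoils
and the figure-eight knot. -/

namespace KnotTheory

/-! ### Colorings of words and their invariance under the moves. -/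

variable {R : Type*} [CommRing R]

/-- The colors `x` and `y` of the edges before and after the passage `l` are compatible with the
colors `f` of the over-arcs. -/
def Step (f : ℕ → R) (l : Letter) (x y : R) : Prop :=
  if l.upper then x = f l.crossing ∧ y = f l.crossing else x + y = 2 * f l.crossing

/-- Colors propagate along `w` from `x` to `y`, where `f` gives the colors of the over-arcs. -/
def Path (f : ℕ → R) : List Letter → R → R → Prop
  | [], x, y => x = y
  | l :: w, x, y => ∃ z, Step f l x z ∧ Path f w z y

/-- The closed word `w` has a non-constant coloring. -/
def ClosedColoring (R : Type*) [CommRing R] (w : List Letter) : Prop :=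
  ∃ (f : ℕ → R) (x : R), Path f w x x ∧ ∃ l ∈ w, f l.crossing ≠ x

theorem Step.symm {f : ℕ → R} {l : Letter} {x y : R} (h : Step f l x y) : Step f l y x := by
  unfold Step at *
  split_ifs at * with hu
  · exact h.symm
  · rw [add_comm]; exact h

theorem path_append {f : ℕ → R} {u v : List Letter} {x z : R} :
    Path f (u ++ v) x z ↔ ∃ y, Path f u x y ∧ Path f v y z := by
  induction u generalizing x with
  | nil => simp [Path]
  | cons l u ih =>
    simp only [List.cons_append, Path, ih]
    constructor
    · rintro ⟨a, h1, b, h2, h3⟩; exact ⟨b, ⟨a, h1, h2⟩, h3⟩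
    · rintro ⟨b, ⟨a, h1, h2⟩, h3⟩; exact ⟨a, h1, b, h2, h3⟩

theorem path_reverse {f : ℕ → R} {w : List Letter} {x y : R} (h : Path f w x y) :
    Path f w.reverse y x := by
  induction w generalizing x with
  | nil => exact h.symm
  | cons l w ih =>
    obtain ⟨z, h1, h2⟩ := h
    rw [List.reverse_cons, path_append]
    exact ⟨z, ih h2, x, h1.symm, rfl⟩

theorem path_congr {f g : ℕ → R} {w : List Letter} (hfg : ∀ l ∈ w, f l.crossing = g l.crossing)
    {x y : R} (h : Path f w x y) : Path g w x y := by
  induction w generalizing x with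
  | nil => exact h
  | cons l w ih =>
    obtain ⟨z, h1, h2⟩ := h
    refine ⟨z, ?_, ih (fun k hk => hfg k (List.mem_cons_of_mem _ hk)) h2⟩
    simpa [Step, hfg l] using h1

theorem path_relabel {f : ℕ → R} {g : ℕ → ℕ} {w : List Letter} {x y : R} :
    Path f (w.map (Letter.relabel g)) x y ↔ Path (f ∘ g) w x y := by
  induction w generalizing x with
  | nil => rfl
  | cons l w ih => simp [Path, ih, Step, Letter.relabel]

theorem path_const {f : ℕ → R} {w : List Letter} {x y : R} (hf : ∀ l ∈ w, f l.crossing = x)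
    (h : Path f w x y) : y = x := by
  induction w with
  | nil => exact h.symm
  | cons l w ih =>
    obtain ⟨z, h1, h2⟩ := h
    have hz : z = x := by
      unfold Step at h1
      rw [hf l List.mem_cons_self] at h1
      split_ifs at h1
      · exact h1.2
      · linear_combination h1
    subst hz
    exact ih (fun k hk => hf k (List.mem_cons_of_mem _ hk)) h2

theorem ClosedColoring.relabel {g : Equiv.Perm ℕ} {w : List Letter} :
    ClosedColoring R (w.map (Letter.relabel g)) ↔ ClosedColoring R w := by
  constructor
  · rintro ⟨f, x, h, l, hl, hne⟩
    obtain ⟨k, hk, rfl⟩ := List.mem_map.1 hl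
    exact ⟨f ∘ g, x, path_relabel.1 h, k, hk, hne⟩
  · rintro ⟨f, x, h, l, hl, hne⟩
    refine ⟨f ∘ g.symm, x, path_relabel.2 ?_, _, List.mem_map_of_mem hl, ?_⟩
    · simpa [Function.comp_assoc] using h
    · simpa [Letter.relabel] using hne

theorem ClosedColoring.rotate {u v : List Letter} (h : ClosedColoring R (u ++ v)) :
    ClosedColoring R (v ++ u) := by
  obtain ⟨f, x, h, hne⟩ := h
  obtain ⟨y, h1, h2⟩ := path_append.1 h
  refine ⟨f, y, path_append.2 ⟨x, h2, h1⟩, ?_⟩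
  by_contra hc
  push Not at hc
  -- If every over-arc had the color of the new base point, that color would persist along `v` up to
  -- the old base point, and the coloring would be constant.
  have := path_const (fun l hl => hc l (List.mem_append_left _ hl)) h2
  subst this
  obtain ⟨l, hl, hn⟩ := hne
  exact hn (hc l (by simp at hl ⊢; tauto))

theorem ClosedColoring.reverse {w : List Letter} (h : ClosedColoring R w) :
    ClosedColoring R w.reverse := by
  obtain ⟨f, x, h, l, hl, hne⟩ := h
  exact ⟨f, x, path_reverse h, l, by simpa using hl, hne⟩

theorem IsGaussCode.crossing_ne {w : List Letter} (hw : IsGaussCode w) {l k : Letter}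
    (hl : l ∈ w) (hk : k ∈ w) (h1 : k ≠ l) (h2 : k ≠ l.flip) : k.crossing ≠ l.crossing := by
  intro h
  rcases hw.2.2 l hl k hk h.symm with h | h
  · exact h1 h
  · exact h2 h

/-- The overpassage gives both its edges the color `f a`, and reflection in `f a` fixes that color,
so a kink is monochromatic. Conversely `f a` is set to the color at the base point. -/
theorem closedColoring_r1 {a : ℕ} {o s : Bool} {u : List Letter}
    (hw : IsGaussCode ([⟨a, o, s⟩, ⟨a, !o, s⟩] ++ u)) :
    ClosedColoring R ([⟨a, o, s⟩, ⟨a, !o, s⟩] ++ u) ↔ ClosedColoring R u := by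
  have fresh : ∀ l ∈ u, l.crossing ≠ a := by
    intro l hl
    have hn := hw.1
    refine hw.crossing_ne (l := ⟨a, o, s⟩) (by simp) (by simp [hl]) ?_ ?_ <;>
    · rintro rfl
      simp [Letter.flip] at hn hl
      tauto
  constructor
  · rintro ⟨f, x, h, l, hl, hne⟩
    simp only [List.cons_append, List.nil_append, Path] at h
    obtain ⟨y, h1, z, h2, h3⟩ := h
    have hx : x = f a ∧ z = f a := by
      cases o <;> simp [Step] at h1 h2
      · exact ⟨by linear_combination h1 - h2.1, h2.2⟩
      · exact ⟨h1.1, by linear_combination h2 - h1.2⟩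
    obtain ⟨rfl, rfl⟩ := hx
    refine ⟨f, f a, h3, l, ?_, hne⟩
    simp only [List.cons_append, List.nil_append, List.mem_cons] at hl
    rcases hl with rfl | rfl | hl
    · exact absurd rfl hne
    · exact absurd rfl hne
    · exact hl
  · rintro ⟨f, x, h, l, hl, hne⟩
    refine ⟨Function.update f a x, x, ?_, l, by simp [hl], ?_⟩
    · have := path_congr (g := Function.update f a x)
        (fun l hl => by rw [Function.update_of_ne (fresh l hl)]) h
      refine ⟨x, ?_, x, ?_, this⟩ <;>
      · cases o <;> simp [Step, two_mul]
    · rwa [Function.update_of_ne (fresh l hl)]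

/-- The upper edge forces `f a = f b`, so the lower strand is reflected twice in the same color and
leaves the bigon unchanged. -/
theorem closedColoring_r2 {a b : ℕ} {s e : Bool} {u v : List Letter}
    (hw : IsGaussCode ([⟨a, true, s⟩, ⟨b, true, !s⟩] ++ u ++
          pair e ⟨a, false, s⟩ ⟨b, false, !s⟩ ++ v)) :
    ClosedColoring R ([⟨a, true, s⟩, ⟨b, true, !s⟩] ++ u ++
          pair e ⟨a, false, s⟩ ⟨b, false, !s⟩ ++ v) ↔ ClosedColoring R (u ++ v) := by
  have fresh : ∀ l ∈ u ++ v, l.crossing ≠ a ∧ l.crossing ≠ b := by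
    intro l hl
    have hn := hw.1
    have hl' : l ∈ u ∨ l ∈ v := by simpa using hl
    refine ⟨hw.crossing_ne (l := ⟨a, true, s⟩) (by simp) (by simp; tauto) ?_ ?_,
      hw.crossing_ne (l := ⟨b, true, !s⟩) (by simp) (by simp; tauto) ?_ ?_⟩ <;>
    · rintro rfl
      cases e <;> simp [Letter.flip, pair, List.nodup_append] at hn hl' <;> grind
  constructor
  · rintro ⟨f, x, h, l, hl, hne⟩
    simp only [path_append] at h
    obtain ⟨y3, ⟨y2, ⟨y1, h1, h2⟩, h3⟩, h4⟩ := h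
    have hx : x = f a ∧ x = f b ∧ y1 = x := by
      simp only [Path, Step, if_true] at h1
      grind
    have h3' : y2 = y3 ∧ x = f a ∧ x = f b ∧ y1 = x := by
      refine ⟨?_, hx⟩
      cases e <;> simp only [Path, Step, pair, if_true, Bool.false_eq_true, if_false] at h3 <;>
        grind
    obtain ⟨rfl, ha, hb, rfl⟩ := h3'
    refine ⟨f, _, path_append.2 ⟨_, h2, h4⟩, l, ?_, hne⟩
    by_contra hc
    have : l.crossing = a ∨ l.crossing = b := by
      cases e <;> simp [pair] at hl hc <;> rcases hl with rfl | rfl | hl | rfl | rfl | hl <;>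
        simp_all
    rcases this with h | h <;> rw [h] at hne
    · exact hne ha.symm
    · exact hne hb.symm
  · rintro ⟨f, x, h, l, hl, hne⟩
    have h := path_congr (g := Function.update (Function.update f a x) b x)
        (fun l hl => by
          rw [Function.update_of_ne (fresh l hl).2, Function.update_of_ne (fresh l hl).1]) h
    set g := Function.update (Function.update f a x) b x with hg
    have hga : g a = x := by simp [hg, Function.update_apply]
    have hgb : g b = x := by simp [hg]
    obtain ⟨y, h1, h2⟩ := path_append.1 h
    refine ⟨g, x, ?_, l, ?_, ?_⟩
    · simp only [path_append]
      refine ⟨y, ⟨y, ⟨x, ?_, h1⟩, ?_⟩, h2⟩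
      · simp [Path, Step, hga, hgb]
      · cases e <;> refine ⟨2 * x - y, ?_, y, ?_, rfl⟩ <;> simp [Step, hga, hgb]
    · simp at hl ⊢; tauto
    · rwa [hg, Function.update_of_ne (fresh l hl).2, Function.update_of_ne (fresh l hl).1]

theorem path_pair_over {f g : ℕ → R} {a b : ℕ} {sa sb t : Bool} {x y : R}
    (hga : g a = f a) (hgb : g b = f b)
    (h : Path f (pair t ⟨a, true, sa⟩ ⟨b, true, sb⟩) x y) :
    Path g (pair (!t) ⟨a, true, sa⟩ ⟨b, true, sb⟩) x y ∧ x = f a ∧ x = f b := by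
  cases t <;> simp [Path, Step, pair, hga, hgb] at h ⊢ <;> grind

theorem path_pair_middle {f g : ℕ → R} {a c : ℕ} {sa sc m : Bool} {x y : R}
    (hga : g a = f a) (hgc : g c = 2 * f a - f c)
    (h : Path f (pair m ⟨a, false, sa⟩ ⟨c, true, sc⟩) x y) :
    Path g (pair (!m) ⟨a, false, sa⟩ ⟨c, true, sc⟩) x y := by
  cases m <;> simp [Path, Step, pair, hga, hgc] at h ⊢ <;> grind

theorem path_pair_bottom {f g : ℕ → R} {b c : ℕ} {sb sc q : Bool} {x y : R}
    (hgb : g b = f b) (hgc : g c = 2 * f b - f c)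
    (h : Path f (pair q ⟨b, false, sb⟩ ⟨c, false, sc⟩) x y) :
    Path g (pair (!q) ⟨b, false, sb⟩ ⟨c, false, sc⟩) x y := by
  cases q <;> simp only [Path, Step, pair, hgb, hgc, if_true, Bool.false_eq_true, if_false,
    Bool.not_true, Bool.not_false] at h ⊢ <;> obtain ⟨z, h1, z', h2, rfl⟩ := h
  · exact ⟨2 * f b - x, by ring, z', by linear_combination h2 - h1, rfl⟩
  · exact ⟨2 * (2 * f b - f c) - x, by ring, z', by linear_combination h2 - h1, rfl⟩

theorem mem_pair {e : Bool} {x y l : Letter} : l ∈ pair e x y ↔ l = x ∨ l = y := by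
  cases e <;> simp [pair, or_comm]

theorem reverse_pair {e : Bool} {x y : Letter} : (pair e x y).reverse = pair (!e) x y := by
  cases e <;> simp [pair]

/-- Only the over-arc at `c` is recolored: sliding it past the top strand reflects its color in the
common color `f a = f b` of that strand. -/
theorem closedColoring_r3 {a b c : ℕ} {sa sb sc t m q : Bool} {u v x : List Letter}
    (hw : IsGaussCode (pair t ⟨a, true, sa⟩ ⟨b, true, sb⟩ ++ u ++
          pair m ⟨a, false, sa⟩ ⟨c, true, sc⟩ ++ v ++
          pair q ⟨b, false, sb⟩ ⟨c, false, sc⟩ ++ x))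
    (h : ClosedColoring R (pair t ⟨a, true, sa⟩ ⟨b, true, sb⟩ ++ u ++
          pair m ⟨a, false, sa⟩ ⟨c, true, sc⟩ ++ v ++
          pair q ⟨b, false, sb⟩ ⟨c, false, sc⟩ ++ x)) :
    ClosedColoring R (pair (!t) ⟨a, true, sa⟩ ⟨b, true, sb⟩ ++ u ++
          pair (!m) ⟨a, false, sa⟩ ⟨c, true, sc⟩ ++ v ++
          pair (!q) ⟨b, false, sb⟩ ⟨c, false, sc⟩ ++ x) := by
  have fresh : (∀ l ∈ u ++ v ++ x, l.crossing ≠ c) ∧ a ≠ c ∧ b ≠ c := by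
    have hn := hw.1
    refine ⟨fun l hl => ?_, ?_, ?_⟩
    · have hl' : l ∈ u ∨ l ∈ v ∨ l ∈ x := by simpa using hl
      refine hw.crossing_ne (l := ⟨c, true, sc⟩) (by cases m <;> simp [pair])
        (by simp; tauto) ?_ ?_ <;>
      · rintro rfl
        cases t <;> cases m <;> cases q <;>
          simp [Letter.flip, pair, List.nodup_append] at hn hl' <;> grind
    · refine hw.crossing_ne (l := ⟨c, true, sc⟩) (k := ⟨a, true, sa⟩)
        (by cases m <;> simp [pair]) (by cases t <;> simp [pair]) ?_ (by simp [Letter.flip])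
      intro h
      rw [h] at hn
      cases t <;> cases m <;> simp [pair, List.nodup_append] at hn
    · refine hw.crossing_ne (l := ⟨c, true, sc⟩) (k := ⟨b, true, sb⟩)
        (by cases m <;> simp [pair]) (by cases t <;> simp [pair]) ?_ (by simp [Letter.flip])
      intro h
      rw [h] at hn
      cases t <;> cases m <;> simp [pair, List.nodup_append] at hn
  obtain ⟨fresh, hac, hbc⟩ := fresh
  obtain ⟨f, z, h, l, hl, hne⟩ := h
  simp only [path_append] at h
  obtain ⟨y5, ⟨y4, ⟨y3, ⟨y2, ⟨y1, h1, h2⟩, h3⟩, h4⟩, h5⟩, h6⟩ := h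
  set g := Function.update f c (2 * f a - f c) with hg
  have hga : g a = f a := by simp [hg, hac]
  have hgb : g b = f b := by simp [hg, hbc]
  have hgc : g c = 2 * f a - f c := by simp [hg]
  have hgu : ∀ l : Letter, l.crossing ≠ c → f l.crossing = g l.crossing := fun l hl => by
    rw [hg, Function.update_of_ne hl]
  obtain ⟨k1, hza, hzb⟩ := path_pair_over hga hgb h1
  have hgc' : g c = 2 * f b - f c := by rw [hgc, ← hza, hzb]
  refine ⟨g, z, ?_, l, ?_, ?_⟩
  · simp only [path_append]
    exact ⟨y5, ⟨y4, ⟨y3, ⟨y2, ⟨y1, k1, path_congr (fun l hl => hgu l (fresh l (by simp [hl]))) h2⟩,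
      path_pair_middle hga hgc h3⟩, path_congr (fun l hl => hgu l (fresh l (by simp [hl]))) h4⟩,
      path_pair_bottom hgb hgc' h5⟩, path_congr (fun l hl => hgu l (fresh l (by simp [hl]))) h6⟩
  · simpa only [List.mem_append, mem_pair] using hl
  · by_cases hlc : l.crossing = c
    · rw [hlc] at hne ⊢
      rw [hgc, ← hza]
      intro h
      exact hne (by linear_combination -h)
    · rwa [← hgu l hlc]

theorem IsGaussCode.perm {w w' : List Letter} (hw : IsGaussCode w) (h : w.Perm w') :
    IsGaussCode w' := by
  refine ⟨h.nodup_iff.1 hw.1, fun l hl => h.mem_iff.1 (hw.2.1 l (h.mem_iff.2 hl)),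
    fun l hl l' hl' => hw.2.2 l (h.mem_iff.2 hl) l' (h.mem_iff.2 hl')⟩

/-- Reversing the word and rotating the top strand back to the front exchanges the two cyclic
orders, which reduces this to `closedColoring_r3`. -/
theorem closedColoring_r3' {a b c : ℕ} {sa sb sc t m q : Bool} {u v x : List Letter}
    (hw : IsGaussCode (pair t ⟨a, true, sa⟩ ⟨b, true, sb⟩ ++ u ++
          pair q ⟨b, false, sb⟩ ⟨c, false, sc⟩ ++ v ++
          pair m ⟨a, false, sa⟩ ⟨c, true, sc⟩ ++ x))
    (h : ClosedColoring R (pair t ⟨a, true, sa⟩ ⟨b, true, sb⟩ ++ u ++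
          pair q ⟨b, false, sb⟩ ⟨c, false, sc⟩ ++ v ++
          pair m ⟨a, false, sa⟩ ⟨c, true, sc⟩ ++ x)) :
    ClosedColoring R (pair (!t) ⟨a, true, sa⟩ ⟨b, true, sb⟩ ++ u ++
          pair (!q) ⟨b, false, sb⟩ ⟨c, false, sc⟩ ++ v ++
          pair (!m) ⟨a, false, sa⟩ ⟨c, true, sc⟩ ++ x) := by
  have key : ∀ t m q : Bool, (pair t ⟨a, true, sa⟩ ⟨b, true, sb⟩ ++ u ++
          pair q ⟨b, false, sb⟩ ⟨c, false, sc⟩ ++ v ++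
          pair m ⟨a, false, sa⟩ ⟨c, true, sc⟩ ++ x).reverse =
        (x.reverse ++ pair (!m) ⟨a, false, sa⟩ ⟨c, true, sc⟩ ++ v.reverse ++
          pair (!q) ⟨b, false, sb⟩ ⟨c, false, sc⟩ ++ u.reverse) ++
          pair (!t) ⟨a, true, sa⟩ ⟨b, true, sb⟩ := by
    intro t m q
    simp [reverse_pair]
  have h1 := h.reverse
  have hw1 := hw.perm (List.reverse_perm _).symm
  rw [key] at h1 hw1
  have h2 := h1.rotate
  have hw2 := hw1.perm List.perm_append_comm
  simp only [← List.append_assoc] at h2 hw2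
  have h3 := closedColoring_r3 hw2 h2
  have h4 : ClosedColoring R (pair (!!t) ⟨a, true, sa⟩ ⟨b, true, sb⟩ ++ (x.reverse ++
      pair (!!m) ⟨a, false, sa⟩ ⟨c, true, sc⟩ ++ v.reverse ++
      pair (!!q) ⟨b, false, sb⟩ ⟨c, false, sc⟩ ++ u.reverse)) := by
    simpa only [← List.append_assoc] using h3
  have h5 := h4.rotate
  rw [← key] at h5
  simpa using h5.reverse

theorem Move.closedColoring_iff {w w' : List Letter} (h : Move w w') (hw : IsGaussCode w)
    (hw' : IsGaussCode w') : ClosedColoring R w ↔ ClosedColoring R w' := by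
  cases h with
  | relabel f w => exact ClosedColoring.relabel.symm
  | rotate u v => exact ⟨fun h => h.rotate, fun h => h.rotate⟩
  | reverse w => exact ⟨fun h => h.reverse, fun h => by simpa using h.reverse⟩
  | r1 a o s u => exact closedColoring_r1 hw
  | r2 a b s e u v => exact closedColoring_r2 hw
  | r3 a b c sa sb sc t m q u v x =>
    exact ⟨fun h => closedColoring_r3 hw h,
      fun h => by simpa using closedColoring_r3 hw' h⟩
  | r3' a b c sa sb sc t m q u v x =>
    exact ⟨fun h => closedColoring_r3' hw h,
      fun h => by simpa using closedColoring_r3' hw' h⟩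

theorem KnotDiagram.closedColoring_iff {D D' : KnotDiagram} (h : D.knot = D'.knot) :
    ClosedColoring R D.word ↔ ClosedColoring R D'.word := by
  have h' := Quot.eqvGen_exact h
  clear h
  induction h' with
  | rel D D' h => exact h.closedColoring_iff D.isGaussCode D'.isGaussCode
  | refl D => rfl
  | symm D D' _ ih => exact ih.symm
  | trans D D' D'' _ _ ih ih' => exact ih.trans ih'

/-! ### Network determinants and the bound for chains of arcs. -/

/-- A function that is zero or the indicator of a single index. -/
def IsUnitOrZero {ι : Type*} (u : ι → ℤ) : Prop :=
  (∀ j, u j = 0 ∨ u j = 1) ∧ ∀ i j, u i = 1 → u j = 1 → i = j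

/-- Along a row with at most one nonzero entry the determinant is expanded. If there is no such row,
every row has exactly one `1` and one `-1`, so the constant vector is in the kernel and the
determinant vanishes. -/
theorem abs_det_le_one_of_network {k : ℕ} (A : Matrix (Fin k) (Fin k) ℤ)
    (u v : Fin k → Fin k → ℤ) (hu : ∀ i, IsUnitOrZero (u i)) (hv : ∀ i, IsUnitOrZero (v i))
    (hA : ∀ i j, A i j = u i j - v i j) : |A.det| ≤ 1 := by
  induction k with
  | zero => simp
  | succ k ih =>
    by_cases h : ∃ i, ∃ j, ∀ j' ≠ j, A i j' = 0
    · obtain ⟨i, j, hj⟩ := h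
      rw [Matrix.det_succ_row A i, Finset.sum_eq_single j (fun b _ hb => by simp [hj b hb])
        (by simp), abs_mul, abs_mul]
      have h1 : |A i j| ≤ 1 := by
        rw [hA]
        rcases (hu i).1 j with h | h <;> rcases (hv i).1 j with h' | h' <;> simp [h, h']
      have h2 := ih (A.submatrix i.succAbove j.succAbove)
        (fun a b => u (i.succAbove a) (j.succAbove b)) (fun a b => v (i.succAbove a) (j.succAbove b))
        (fun a => ⟨fun b => (hu _).1 _,
          fun b b' hb hb' => Fin.succAbove_right_injective ((hu _).2 _ _ hb hb')⟩)
        (fun a => ⟨fun b => (hv _).1 _,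
          fun b b' hb hb' => Fin.succAbove_right_injective ((hv _).2 _ _ hb hb')⟩)
        (fun a b => by simp [hA])
      rw [abs_pow, abs_neg, abs_one, one_pow, one_mul]
      exact mul_le_one₀ h1 (abs_nonneg _) h2
    · push Not at h
      have : A.mulVec (fun _ => 1) = 0 := by
        ext i
        simp only [Matrix.mulVec, dotProduct, mul_one, hA, Finset.sum_sub_distrib, Pi.zero_apply]
        have key : ∀ (u v : Fin k.succ → ℤ), IsUnitOrZero u → IsUnitOrZero v →
            (∀ j, ∃ j', j' ≠ j ∧ u j' - v j' ≠ 0) → ∑ j, u j = 1 := by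
          intro u v hu hv h
          have : ∃ j, u j = 1 := by
            by_contra hc
            push Not at hc
            have hu0 : ∀ j, u j = 0 := fun j => (hu.1 j).resolve_right (hc j)
            obtain ⟨j, -, hj⟩ := h 0
            obtain ⟨j', hne, hj'⟩ := h j
            have e1 : v j = 1 := (hv.1 j).resolve_left (by simpa [hu0] using hj)
            have e2 : v j' = 1 := (hv.1 j').resolve_left (by simpa [hu0] using hj')
            exact hne (hv.2 _ _ e2 e1)
          obtain ⟨j, hj⟩ := this
          rw [Finset.sum_eq_single j, hj]
          · intro b _ hb
            exact (hu.1 b).resolve_right fun h => hb (hu.2 _ _ h hj)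
          · simp
        rw [key (u i) (v i) (hu i) (hv i), key (v i) (u i) (hv i) (hu i), sub_self]
        · intro j
          obtain ⟨j', h1, h2⟩ := h i j
          exact ⟨j', h1, by rw [hA] at h2; omega⟩
        · intro j
          obtain ⟨j', h1, h2⟩ := h i j
          exact ⟨j', h1, by rwa [hA] at h2⟩
      have h0 := Matrix.exists_mulVec_eq_zero_iff.1 ⟨fun _ => 1, by
        intro h; simpa using congrFun h 0, this⟩
      simp [h0]

/-- By multilinearity in the rows the determinant is a sum over the `2 ^ k` ways to take each row
from `A` or from `B`. -/
theorem abs_det_add_le {k : ℕ} (A B : Matrix (Fin k) (Fin k) ℤ)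
    (h : ∀ s : Finset (Fin k), |Matrix.det (s.piecewise A B)| ≤ 1) :
    |(A + B).det| ≤ 2 ^ k := by
  have h1 : (A + B).det = ∑ s : Finset (Fin k), Matrix.det (s.piecewise A B) :=
    (Matrix.detRowAlternating (R := ℤ) (n := Fin k)).toMultilinearMap.map_add_univ A B
  rw [h1]
  calc _ ≤ ∑ s : Finset (Fin k), |Matrix.det (s.piecewise A B)| := Finset.abs_sum_le_sum_abs _ _
    _ ≤ ∑ s : Finset (Fin k), 1 := Finset.sum_le_sum fun s _ => h s
    _ = 2 ^ k := by simp

theorem isUnitOrZero_indicator {k : ℕ} (m : ℕ) :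
    IsUnitOrZero (fun j : Fin k => if m = (j : ℕ) + 1 then (1 : ℤ) else 0) := by
  refine ⟨fun j => by by_cases h : m = (j : ℕ) + 1 <;> simp [h], fun i j hi hj => ?_⟩
  simp at hi hj
  ext; omega

/-- A sequence of colors along a chain of crossings whose over-arcs belong to the chain. -/
theorem chain_bound {p : ℕ} (hp : p.Prime) (hodd : p ≠ 2) (k : ℕ) (a : ℕ → ZMod p) (t : ℕ → ℕ)
    (ht : ∀ i < k, t i ≤ k) (h : ∀ i < k, a i + a (i + 1) = 2 * a (t i))
    (hne : ∃ i ≤ k, a i ≠ a 0) : p < 2 ^ k := by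
  have := Fact.mk hp
  -- The unknowns are the differences `a (j + 1) - a 0`; `e m` is the coordinate vector of `a m - a
  -- 0`, so `e 0` is zero.
  let e (m : ℕ) (j : Fin k) : ℤ := if m = (j : ℕ) + 1 then 1 else 0
  have he : ∀ m, IsUnitOrZero (e m) := fun m => isUnitOrZero_indicator m
  let A : Matrix (Fin k) (Fin k) ℤ := Matrix.of fun i j => e i j - e (t i) j
  let B : Matrix (Fin k) (Fin k) ℤ := Matrix.of fun i j => e (i + 1) j - e (t i) j
  have hle : |(A + B).det| ≤ 2 ^ k := by
    refine abs_det_add_le A B fun s => ?_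
    refine abs_det_le_one_of_network _ (s.piecewise (fun i j => e i j) (fun i j => e (i + 1) j))
      (fun i j => e (t i) j) ?_ (fun i => he _) ?_
    · intro i
      by_cases hi : i ∈ s <;> simp [hi, he]
    · intro i j
      by_cases hi : i ∈ s
      · simp only [hi, Finset.piecewise_eq_of_mem]
        exact congrFun (Finset.piecewise_eq_of_mem s A B hi) j
      · simp only [hi, Finset.piecewise_eq_of_notMem, not_false_eq_true]
        exact congrFun (Finset.piecewise_eq_of_notMem s A B hi) j
  -- Modulo `2` the doubled terms `e (t i)` vanish; the rows `e i + e (i + 1)` form a lower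
  -- triangular matrix with ones on the diagonal.
  have hdet2 : (((A + B).det : ℤ) : ZMod 2) = 1 := by
    rw [Int.cast_det, Matrix.det_of_isLowerTriangular]
    · refine Finset.prod_eq_one fun i _ => ?_
      simp [A, B, e]
    · intro i j hij
      have hij : (i : ℕ) < j := hij
      have h1 : (i : ℕ) ≠ j + 1 := by omega
      have h2 : (i : ℕ) ≠ j := by omega
      simp [A, B, e, h1, h2]
      split_ifs <;> rfl
  have hdvd : (p : ℤ) ∣ (A + B).det := by
    rw [← ZMod.intCast_zmod_eq_zero_iff_dvd, Int.cast_det]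
    refine Matrix.exists_mulVec_eq_zero_iff.1 ⟨fun j => a (j + 1) - a 0, ?_, ?_⟩
    · intro h0
      obtain ⟨i, hi, hne⟩ := hne
      obtain _ | i := i
      · exact hne rfl
      · exact hne (sub_eq_zero.1 (congrFun h0 ⟨i, hi⟩))
    · have key : ∀ m ≤ k, ∑ j : Fin k, ((e m j : ℤ) : ZMod p) * (a (j + 1) - a 0) = a m - a 0 := by
        intro m hm
        obtain _ | m := m
        · simp [e]
        · rw [Finset.sum_eq_single ⟨m, hm⟩]
          · simp [e]
          · intro b _ hb
            have : m ≠ b := fun h => hb (by ext; exact h.symm)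
            simp [e, this]
          · simp
      ext i
      have h1 := key i i.2.le
      have h2 := key (i + 1) i.2
      have h3 := key (t i) (ht i i.2)
      have h4 := h i i.2
      simp only [Matrix.mulVec, dotProduct, Matrix.map_apply, Matrix.add_apply, A, B, Matrix.of_apply,
        Int.cast_add, Int.cast_sub, add_mul, sub_mul, Finset.sum_add_distrib, Finset.sum_sub_distrib,
        h1, h2, h3, Pi.zero_apply]
      linear_combination h4
  have h0 : (A + B).det ≠ 0 := by
    intro h0
    rw [h0] at hdet2
    exact absurd hdet2 (by decide)
  have h1 : (p : ℤ) ≤ 2 ^ k := (Int.le_of_dvd (abs_pos.2 h0) ((dvd_abs _ _).2 hdvd)).trans hle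
  refine lt_of_le_of_ne (by exact_mod_cast h1) fun h2 => ?_
  have h3 : p ∣ 2 := hp.dvd_of_dvd_pow (dvd_of_eq h2)
  exact hodd ((Nat.prime_dvd_prime_iff_eq hp Nat.prime_two).1 h3)

/-! ### Non-alternating codes. -/

theorem path_iff_seq {f : ℕ → R} {w : List Letter} {x y : R} :
    Path f w x y ↔ ∃ a : ℕ → R, a 0 = x ∧ a w.length = y ∧
      ∀ (i : ℕ) (h : i < w.length), Step f w[i] (a i) (a (i + 1)) := by
  induction w generalizing x with
  | nil =>
    constructor
    · intro h; exact ⟨fun _ => x, rfl, h, fun i h => by simp at h⟩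
    · rintro ⟨a, rfl, rfl, -⟩; rfl
  | cons l w ih =>
    simp only [Path, ih]
    constructor
    · rintro ⟨z, h1, a, rfl, rfl, h2⟩
      refine ⟨fun i => Nat.casesOn i x a, rfl, rfl, ?_⟩
      rintro (_ | i) hi
      · exact h1
      · exact h2 i (by simpa using hi)
    · rintro ⟨a, rfl, rfl, h⟩
      exact ⟨a 1, h 0 (by simp), fun i => a (i + 1), rfl, rfl,
        fun i hi => h (i + 1) (by simpa using hi)⟩

/-- Records a path by its arcs: `a i` is the color after `i` underpassages and `c i` the crossing of
the next one. Overpassages do not end an arc, so their colors occur among the `a j`. -/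
theorem path_chain {f : ℕ → R} {w : List Letter} {x y : R} (h : Path f w x y) :
    ∃ (a : ℕ → R) (c : ℕ → ℕ), a 0 = x ∧ a (w.countP fun l => !l.upper) = y ∧
      (∀ i < w.countP fun l => !l.upper, a i + a (i + 1) = 2 * f (c i) ∧
        ∃ l ∈ w, l.upper = false ∧ l.crossing = c i) ∧
      ∀ l ∈ w, l.upper = true → ∃ j ≤ w.countP fun l => !l.upper, f l.crossing = a j := by
  induction w generalizing x with
  | nil => exact ⟨fun _ => x, fun _ => 0, rfl, h, by simp, by simp⟩
  | cons l w ih =>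
    obtain ⟨z, h1, h2⟩ := h
    obtain ⟨a, c, rfl, rfl, h3, h4⟩ := ih h2
    cases hl : l.upper
    · simp only [Step, hl, Bool.false_eq_true, if_false] at h1
      have hk : (l :: w).countP (fun l => !l.upper) = w.countP (fun l => !l.upper) + 1 := by
        simp [hl]
      rw [hk]
      refine ⟨fun i => Nat.casesOn i x a, fun i => Nat.casesOn i l.crossing c, rfl, rfl, ?_, ?_⟩
      · rintro (_ | i) hi
        · exact ⟨h1, l, by simp, hl, rfl⟩
        · obtain ⟨h5, l', h6, h7⟩ := h3 i (by omega)
          exact ⟨h5, l', by simp [h6], h7⟩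
      · intro l' hl' hu
        rcases List.mem_cons.1 hl' with rfl | hl'
        · simp [hl] at hu
        · obtain ⟨j, hj, hj'⟩ := h4 l' hl' hu
          exact ⟨j + 1, by omega, hj'⟩
    · simp only [Step, hl, if_true] at h1
      have hk : (l :: w).countP (fun l => !l.upper) = w.countP (fun l => !l.upper) := by
        simp [hl]
      rw [hk]
      refine ⟨a, c, by rw [h1.1, h1.2], rfl, ?_, ?_⟩
      · intro i hi
        obtain ⟨h5, l', h6, h7⟩ := h3 i hi
        exact ⟨h5, l', by simp [h6], h7⟩
      · intro l' hl' hu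
        rcases List.mem_cons.1 hl' with rfl | hl'
        · exact ⟨0, by omega, h1.2.symm⟩
        · exact h4 l' hl' hu

theorem IsGaussCode.card_filter_upper {w : List Letter} (hw : IsGaussCode w) (s : Bool) :
    (w.toFinset.filter fun l => l.upper = s).card = numCrossings w := by
  unfold numCrossings
  have : w.toFinset.image Letter.crossing =
      (w.toFinset.filter fun l => l.upper = s).image Letter.crossing := by
    ext c
    simp only [Finset.mem_image, List.mem_toFinset, Finset.mem_filter]
    constructor
    · rintro ⟨l, hl, rfl⟩
      by_cases hs : l.upper = s
      · exact ⟨l, ⟨hl, hs⟩, rfl⟩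
      · exact ⟨l.flip, ⟨hw.2.1 l hl, by cases s <;> simpa [Letter.flip] using hs⟩, rfl⟩
    · rintro ⟨l, ⟨hl, -⟩, rfl⟩
      exact ⟨l, hl, rfl⟩
  rw [this, Finset.card_image_of_injOn]
  intro l hl l' hl' h
  simp only [Finset.coe_filter, List.mem_toFinset, Set.mem_ofPred_eq] at hl hl'
  rcases hw.2.2 l hl.1 l' hl'.1 h with h | h
  · exact h.symm
  · have h1 := hl.2
    have h2 := hl'.2
    rw [h] at h2
    simp [Letter.flip, h1] at h2

theorem IsGaussCode.countP_lower {w : List Letter} (hw : IsGaussCode w) :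
    (w.countP fun l => !l.upper) = numCrossings w := by
  rw [← hw.card_filter_upper false, List.countP_eq_length_filter,
    ← List.toFinset_card_of_nodup (hw.1.filter _), List.toFinset_filter]
  congr 1
  ext l
  simp

theorem numCrossings_perm {w w' : List Letter} (h : w.Perm w') :
    numCrossings w = numCrossings w' := by
  rw [numCrossings, numCrossings, List.toFinset_eq_of_perm _ _ h]

/-- The bound for a code in which an arc is bounded by two consecutive underpassages. -/
theorem lt_two_pow_of_under_ends {p : ℕ} (hp : p.Prime) (hodd : p ≠ 2) {l₀ l₁ : Letter}
    {m : List Letter} (hw : IsGaussCode (l₀ :: (m ++ [l₁]))) (h₀ : l₀.upper = false)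
    (h₁ : l₁.upper = false) (hc : ClosedColoring (ZMod p) (l₀ :: (m ++ [l₁]))) :
    p < 2 ^ (numCrossings (l₀ :: (m ++ [l₁])) - 2) := by
  obtain ⟨f, x, ⟨z, hs, h⟩, hne⟩ := hc
  obtain ⟨y, h', y', hs', rfl⟩ := path_append.1 h
  obtain ⟨a, c, rfl, rfl, h3, h4⟩ := path_chain h'
  -- Of the `n` underpassages two are the ends of the word, so `m` contains `n - 2`.
  have hk : (m.countP fun l => !l.upper) = numCrossings (l₀ :: (m ++ [l₁])) - 2 := by
    rw [← hw.countP_lower]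
    simp [h₀, h₁]
  rw [hk] at h3 h4 hs'
  set k := numCrossings (l₀ :: (m ++ [l₁])) - 2
  -- No overpassage is at an end of the word, so each lies in `m` and its color is in the chain.
  have hover : ∀ l ∈ l₀ :: (m ++ [l₁]), ∃ j ≤ k, f l.crossing = a j := by
    intro l hl
    obtain ⟨l', hl', hu, hcr⟩ : ∃ l' ∈ l₀ :: (m ++ [l₁]), l'.upper = true ∧
        l'.crossing = l.crossing := by
      cases hu : l.upper
      · exact ⟨l.flip, hw.2.1 l hl, by simp [Letter.flip, hu], rfl⟩
      · exact ⟨l, hl, hu, rfl⟩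
    rw [← hcr]
    refine h4 l' ?_ hu
    simp only [List.mem_cons, List.mem_append, List.not_mem_nil, or_false] at hl'
    rcases hl' with rfl | hl' | rfl
    · simp [h₀] at hu
    · exact hl'
    · simp [h₁] at hu
  have h5 : ∀ i, ∃ j ≤ k, i < k → f (c i) = a j := by
    intro i
    by_cases hi : i < k
    · obtain ⟨-, l, hl, -, hlc⟩ := h3 i hi
      obtain ⟨j, hj, hj'⟩ := hover l (by simp [hl])
      exact ⟨j, hj, fun _ => by rw [← hlc, hj']⟩
    · exact ⟨0, by omega, fun h => absurd h hi⟩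
  choose t ht ht' using h5
  refine chain_bound hp hodd k a t (fun i _ => ht i) (fun i hi => by rw [(h3 i hi).1, ht' i hi]) ?_
  by_contra hcon
  push Not at hcon
  have hall : ∀ l ∈ l₀ :: (m ++ [l₁]), f l.crossing = a 0 := by
    intro l hl
    obtain ⟨j, hj, hj'⟩ := hover l hl
    rw [hj', hcon j hj]
  have hx : y' = a 0 := by
    simp only [Step, h₀, Bool.false_eq_true, if_false, hall l₀ (by simp)] at hs
    linear_combination hs
  obtain ⟨l, hl, hne⟩ := hne
  exact hne (by rw [hall l hl, hx])

/-- Without two consecutive underpassages, the successor map injects the lower letters into the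
upper ones. These are equally many, so every upper letter follows a lower one and the code
alternates. -/
theorem IsGaussCode.lt_two_pow_or_alternating {p : ℕ} (hp : p.Prime) (hodd : p ≠ 2)
    {w : List Letter} (hw : IsGaussCode w) (hc : ClosedColoring (ZMod p) w) :
    p < 2 ^ (numCrossings w - 2) ∨ ∀ l ∈ w, (w.formPerm l).upper = !l.upper := by
  by_cases h : ∃ l ∈ w, l.upper = false ∧ (w.formPerm l).upper = false
  · left
    obtain ⟨l, hl, hu, hu'⟩ := h
    obtain ⟨u, v, rfl⟩ := List.append_of_mem hl
    have hrot : (u ++ [l]) ++ v ~r v ++ (u ++ [l]) := List.isRotated_append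
    rw [show u ++ l :: v = (u ++ [l]) ++ v by simp] at hw hc hl hu' ⊢
    rw [List.formPerm_eq_of_isRotated hw.1 hrot] at hu'
    rw [numCrossings_perm hrot.perm]
    replace hc := hc.rotate
    replace hw := hw.perm hrot.perm
    cases hvu : v ++ u with
    | nil =>
      obtain ⟨rfl, rfl⟩ := List.append_eq_nil_iff.1 hvu
      have := hw.2.1 l (by simp)
      exact absurd (congrArg Letter.upper (List.mem_singleton.1 this)) (by simp [Letter.flip])
    | cons k m =>
      rw [← List.append_assoc, hvu] at hu' hw hc ⊢
      rw [List.cons_append] at hu' hw hc ⊢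
      rw [List.formPerm_cons_concat_apply_last] at hu'
      exact lt_two_pow_of_under_ends hp hodd hw hu' hu hc
  · right
    push Not at h
    have hlow : ∀ l ∈ w, l.upper = false → (w.formPerm l).upper = true := by
      intro l hl hu
      simpa using h l hl hu
    intro l hl
    cases hu : l.upper
    · simpa using hlow l hl hu
    · by_contra hcon
      have hcon : (w.formPerm l).upper = true := by simpa using hcon
      have hsurj := Finset.surj_on_of_inj_on_of_card_le
        (s := w.toFinset.filter fun l => l.upper = false)
        (t := w.toFinset.filter fun l => l.upper = true) (fun l _ => w.formPerm l)
        (fun l hl => by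
          simp only [Finset.mem_filter, List.mem_toFinset] at hl ⊢
          exact ⟨List.formPerm_apply_mem_of_mem hl.1, hlow l hl.1 hl.2⟩)
        (fun a b _ _ h => w.formPerm.injective h)
        (by rw [hw.card_filter_upper, hw.card_filter_upper])
        (w.formPerm l) (by
          simp only [Finset.mem_filter, List.mem_toFinset]
          exact ⟨List.formPerm_apply_mem_of_mem hl, hcon⟩)
      obtain ⟨l', hl', heq⟩ := hsurj
      rw [w.formPerm.injective heq] at hu
      simp [hu] at hl'

/-! ### Passage between closed colorings and colorings of the edges. -/

theorem IsGaussCode.exists_edge_coloring {w : List Letter} (hw : IsGaussCode w)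
    (hc : ClosedColoring R w) :
    ∃ (f : ℕ → R) (col : Letter → R),
      (∀ l ∈ w, Step f (w.formPerm l) (col l) (col (w.formPerm l))) ∧
      ∃ l ∈ w, ∃ l' ∈ w, col l ≠ col l' := by
  obtain ⟨f, x, h, hne⟩ := hc
  obtain ⟨a, ha0, halen, ha⟩ := path_iff_seq.1 h
  have hidx : ∀ (i : ℕ) (hi : i < w.length), w.idxOf w[i] = i := fun i hi =>
    hw.1.idxOf_getElem i hi
  -- The shift by one is there because `col l` belongs to the edge that leaves `l`.
  refine ⟨f, fun l => a (w.idxOf l + 1), ?_, ?_⟩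
  · intro l hl
    obtain ⟨i, hi, rfl⟩ := List.getElem_of_mem hl
    rw [List.formPerm_apply_getElem _ hw.1]
    simp only [hidx]
    by_cases hlast : i + 1 < w.length
    · simp only [Nat.mod_eq_of_lt hlast]
      exact ha _ hlast
    · have hlast : i + 1 = w.length := by omega
      simp only [hlast, Nat.mod_self, halen]
      rw [← ha0]
      exact ha 0 (by omega)
  · by_contra hcon
    push Not at hcon
    obtain ⟨l, hl, hne⟩ := hne
    obtain ⟨l', hl', hu, hcr⟩ : ∃ l' ∈ w, l'.upper = true ∧ l'.crossing = l.crossing := by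
      cases hu : l.upper
      · exact ⟨l.flip, hw.2.1 l hl, by simp [Letter.flip, hu], rfl⟩
      · exact ⟨l, hl, hu, rfl⟩
    obtain ⟨i, hi, rfl⟩ := List.getElem_of_mem hl'
    have h1 := ha i hi
    simp only [Step, hu, if_true, hcr] at h1
    have h2 := hcon _ (List.getElem_mem hi) w[w.length - 1] (List.getElem_mem _)
    simp only [hidx, show w.length - 1 + 1 = w.length by omega, halen] at h2
    exact hne (by rw [← h1.2, h2])

theorem KnotDiagram.HasNontrivialColoring.closedColoring {D : KnotDiagram} {m : ℕ}
    (h : D.HasNontrivialColoring m) : ClosedColoring (ZMod m) D.word := by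
  obtain ⟨col, hcol, l₁, hl₁, l₂, hl₂, hne⟩ := h
  have hw := D.isGaussCode
  set w := D.word with hwD
  have hpos : 0 < w.length := List.length_pos_of_mem hl₁
  obtain ⟨f, hf⟩ : ∃ f : ℕ → ZMod m, ∀ l ∈ w, l.upper = true → f l.crossing = col l := by
    classical
    refine ⟨fun c => if h : ∃ l ∈ w, l.upper = true ∧ l.crossing = c then col h.choose else 0, ?_⟩
    intro l hl hu
    have h : ∃ l' ∈ w, l'.upper = true ∧ l'.crossing = l.crossing := ⟨l, hl, hu, rfl⟩
    beta_reduce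
    rw [dif_pos h]
    obtain ⟨h1, h2, h3⟩ := h.choose_spec
    rcases hw.2.2 l hl _ h1 h3.symm with h | h
    · rw [h]
    · rw [h] at h2
      simp [Letter.flip, hu] at h2
  have hstep : ∀ l ∈ w, Step f (w.formPerm l) (col l) (col (w.formPerm l)) := by
    intro l hl
    have h := hcol l hl
    have hm : w.formPerm l ∈ w := List.formPerm_apply_mem_of_mem hl
    simp only [← hwD] at h
    unfold Step
    split_ifs at h ⊢ with hu
    · rw [hf _ hm hu]
      exact ⟨h, rfl⟩
    · rw [h]
      have := hf _ (hw.2.1 _ hm) (by simpa [Letter.flip] using hu)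
      rw [← this]
      rfl
  have hlast : w.length - 1 < w.length := by omega
  -- The edge through the base point leaves the last letter, hence the value at `0`. The default `0`
  -- concerns only indices beyond the word.
  let a : ℕ → ZMod m := fun i => Nat.casesOn i (col w[w.length - 1]) fun j => (w[j]?).elim 0 col
  have ha : ∀ (j : ℕ) (hj : j < w.length), a (j + 1) = col w[j] := by
    intro j hj
    simp [a, hj]
  have hpath : Path f w (a 0) (a 0) := by
    refine path_iff_seq.2 ⟨a, rfl, ?_, ?_⟩
    · have := ha (w.length - 1) hlast
      rwa [show w.length - 1 + 1 = w.length by omega] at this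
    · rintro (_ | i) hi
      · rw [ha 0 hi]
        have := hstep _ (List.getElem_mem hlast)
        rw [List.formPerm_apply_getElem _ hw.1] at this
        simp only [show w.length - 1 + 1 = w.length by omega, Nat.mod_self] at this
        exact this
      · rw [ha _ hi, ha i (by omega)]
        have := hstep _ (List.getElem_mem (by omega : i < w.length))
        rw [List.formPerm_apply_getElem _ hw.1] at this
        simpa only [Nat.mod_eq_of_lt hi] using this
  refine ⟨f, a 0, hpath, by_contra fun hcon => ?_⟩
  push Not at hcon
  have hconst : ∀ (j : ℕ) (hj : j < w.length), col w[j] = a 0 := by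
    intro j hj
    induction j with
    | zero =>
      have := hstep _ (List.getElem_mem hlast)
      rw [List.formPerm_apply_getElem _ hw.1] at this
      simp only [show w.length - 1 + 1 = w.length by omega, Nat.mod_self] at this
      rw [Step, hcon _ (List.getElem_mem hj)] at this
      split_ifs at this with hu
      · exact this.2
      · have h0 : a 0 = col w[w.length - 1] := rfl
        linear_combination this + h0
    | succ j ih =>
      have := hstep _ (List.getElem_mem (by omega : j < w.length))
      rw [List.formPerm_apply_getElem _ hw.1] at this
      simp only [Nat.mod_eq_of_lt hj] at this
      rw [Step, hcon _ (List.getElem_mem hj), ih (by omega)] at this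
      split_ifs at this with hu
      · exact this.2
      · linear_combination this
  obtain ⟨i, hi, rfl⟩ := List.getElem_of_mem hl₁
  obtain ⟨j, hj, rfl⟩ := List.getElem_of_mem hl₂
  exact hne (by rw [hconst i hi, hconst j hj])

/-! ### Spanning trees and the inequality of arithmetic and geometric means. -/

theorem prod_mul_card_pow_le {ι : Type*} [Fintype ι] (z : ι → ℝ) (hz : ∀ i, 0 ≤ z i) :
    (∏ i, z i) * (Fintype.card ι : ℝ) ^ Fintype.card ι ≤ (∑ i, z i) ^ Fintype.card ι := by
  rcases isEmpty_or_nonempty ι with h | h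
  · simp
  have hpos : (0 : ℝ) < Fintype.card ι := by exact_mod_cast Fintype.card_pos
  have h1 := Real.geom_mean_le_arith_mean Finset.univ (fun _ => (1 : ℝ)) z (by simp)
    (by simpa using hpos) (fun i _ => hz i)
  simp only [Real.rpow_one, Finset.sum_const, Finset.card_univ, nsmul_eq_mul, mul_one, one_mul] at h1
  have h0 : 0 ≤ ∏ i, z i := Finset.prod_nonneg fun i _ => hz i
  have h2 := pow_le_pow_left₀ (Real.rpow_nonneg h0 _) h1 (Fintype.card ι)
  rw [← Real.rpow_natCast, ← Real.rpow_mul h0, inv_mul_cancel₀ hpos.ne', Real.rpow_one,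
    div_pow] at h2
  rwa [le_div_iff₀ (by positivity)] at h2

theorem PosSemidef.det_mul_card_pow_le {ι : Type*} [Fintype ι] [DecidableEq ι] {S : Matrix ι ι ℝ}
    (hS : S.PosSemidef) :
    S.det * (Fintype.card ι : ℝ) ^ Fintype.card ι ≤ S.trace ^ Fintype.card ι := by
  have h1 := hS.isHermitian.det_eq_prod_eigenvalues
  have h2 := hS.isHermitian.trace_eq_sum_eigenvalues
  simp only [RCLike.ofReal_real_eq_id, id_eq] at h1 h2
  rw [h1, h2]
  exact prod_mul_card_pow_le _ hS.eigenvalues_nonneg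

open scoped MatrixOrder in
theorem PosSemidef.exists_eq_conjTranspose_mul {ι : Type*} [Fintype ι] [DecidableEq ι]
    {S : Matrix ι ι ℝ} (hS : S.PosSemidef) : ∃ B : Matrix ι ι ℝ, S = B.conjTranspose * B :=
  CStarAlgebra.nonneg_iff_eq_star_mul_self.mp hS.nonneg

/-- With `J` the all-ones matrix and `1 + J = Bᴴ * B`, AM-GM is applied to the eigenvalues of `B * L
* Bᴴ`: the determinant gains the factor `det (1 + J)`, the trace gains the sum of the entries of
`L`. -/
theorem det_mul_card_pow_le_trace_add {ι : Type*} [Fintype ι] [DecidableEq ι] {L : Matrix ι ι ℝ}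
    (hL : L.PosSemidef) :
    ((Fintype.card ι : ℝ) + 1) * L.det * (Fintype.card ι : ℝ) ^ Fintype.card ι ≤
      (L.trace + ∑ i, ∑ j, L i j) ^ Fintype.card ι := by
  have hA : (1 + Matrix.vecMulVec (fun _ : ι => (1 : ℝ)) (star fun _ => 1)).PosSemidef :=
    Matrix.PosSemidef.one.add (Matrix.posSemidef_vecMulVec_self_star _)
  obtain ⟨B, hB⟩ := PosSemidef.exists_eq_conjTranspose_mul hA
  have h := PosSemidef.det_mul_card_pow_le (hL.mul_mul_conjTranspose_same B)
  have hdet : (B * L * B.conjTranspose).det = ((Fintype.card ι : ℝ) + 1) * L.det := by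
    rw [Matrix.det_mul, Matrix.det_mul, mul_right_comm, mul_comm B.det, ← Matrix.det_mul, ← hB,
      Matrix.vecMulVec_eq Unit, Matrix.det_one_add_replicateCol_mul_replicateRow]
    simp [dotProduct, add_comm]
  have htr : (B * L * B.conjTranspose).trace = L.trace + ∑ i, ∑ j, L i j := by
    rw [Matrix.mul_assoc, Matrix.trace_mul_comm, Matrix.mul_assoc, ← hB, mul_add, mul_one,
      Matrix.trace_add]
    congr 1
    simp [Matrix.trace, Matrix.mul_apply, Matrix.vecMulVec_apply]
  rwa [hdet, htr] at h

section

variable {Ω V : Type*} [DecidableEq V]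

/-- The incidence matrix of the graph with edges `Ω`, where `F c β` are the ends of `c`. -/
def incidence (R : Type*) [Ring R] (F : Ω → Bool → V) : Matrix Ω V R :=
  Matrix.of fun c v => (if F c true = v then 1 else 0) - (if F c false = v then 1 else 0)

theorem incidence_mulVec [Fintype V] {R : Type*} [Ring R] (F : Ω → Bool → V) (y : V → R) (c : Ω) :
    (incidence R F).mulVec y c = y (F c true) - y (F c false) := by
  simp [incidence, Matrix.mulVec, dotProduct, sub_mul]

/-- If the Laplacian of a connected graph with edges `Ω` has a non-constant kernel vector modulo
`p`, then `p` divides its number of spanning trees, which is bounded by means of the inequality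
of arithmetic and geometric means. -/
theorem card_mul_prime_mul_le [Fintype Ω] [Fintype V] {p : ℕ} (hp : p.Prime) (F : Ω → Bool → V)
    (hconn : ∀ y : V → ℝ, (∀ c, y (F c true) = y (F c false)) → ∀ v v', y v = y v')
    (y : V → ZMod p) (hy : (incidence (ZMod p) F).transpose.mulVec
      ((incidence (ZMod p) F).mulVec y) = 0) (hne : ∃ v v', y v ≠ y v') :
    Fintype.card V * p * (Fintype.card V - 1) ^ (Fintype.card V - 1) ≤
      (2 * Fintype.card Ω) ^ (Fintype.card V - 1) := by
  have := Fact.mk hp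
  obtain ⟨v₁, v₀, hne⟩ := hne
  -- Deleting `v₀` gives the reduced Laplacian `L`. Its integer determinant is compared with its
  -- images modulo `p` and over `ℝ`.
  let I := {v : V // v ≠ v₀}
  have hcardI : Fintype.card I = Fintype.card V - 1 := by
    simp [I, Fintype.card_subtype_compl]
  have hcardV : 1 ≤ Fintype.card V := Fintype.card_pos_iff.2 ⟨v₀⟩
  let D (R : Type) [CommRing R] : Matrix Ω I R := (incidence R F).submatrix id Subtype.val
  let L (R : Type) [CommRing R] : Matrix I I R := (D R).transpose * D R
  have hDmap : ∀ (R : Type) [CommRing R], (D ℤ).map (Int.castRingHom R) = D R := by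
    intro R _
    ext c v
    simp [D, incidence]
  have hLmap : ∀ (R : Type) [CommRing R], (L ℤ).map (Int.castRingHom R) = L R := by
    intro R _
    simp only [L, Matrix.map_mul, Matrix.transpose_map, hDmap]
  have hdet : ∀ (R : Type) [CommRing R], ((L ℤ).det : R) = (L R).det := by
    intro R _
    rw [← hLmap R]
    exact RingHom.map_det (Int.castRingHom R) (L ℤ)
  have hD : ∀ (R : Type) [CommRing R] (z : V → R), z v₀ = 0 → ∀ c,
      (D R).mulVec (fun i => z i) c = z (F c true) - z (F c false) := by
    intro R _ z hz c
    rw [← incidence_mulVec]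
    simp only [Matrix.mulVec, dotProduct, D, Matrix.submatrix_apply, id_eq]
    rw [Fintype.sum_eq_add_sum_subtype_ne _ v₀, hz, mul_zero, zero_add]
  have hdvd : (p : ℤ) ∣ (L ℤ).det := by
    rw [← ZMod.intCast_zmod_eq_zero_iff_dvd, hdet]
    refine Matrix.exists_mulVec_eq_zero_iff.1 ⟨fun i => y i - y v₀, ?_, ?_⟩
    · intro h0
      refine hne (sub_eq_zero.1 (congrFun h0 ⟨v₁, ?_⟩))
      rintro rfl
      exact hne rfl
    · rw [← Matrix.mulVec_mulVec]
      have : (D (ZMod p)).mulVec (fun i => y i - y v₀) = (incidence (ZMod p) F).mulVec y := by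
        ext c
        rw [hD (ZMod p) (fun v => y v - y v₀) (sub_self _), incidence_mulVec]
        ring
      rw [this]
      ext i
      exact congrFun hy i
  have hpsd : (L ℝ).PosSemidef := by
    have := Matrix.posSemidef_conjTranspose_mul_self (D ℝ)
    rwa [Matrix.conjTranspose_eq_transpose_of_trivial] at this
  -- A kernel vector, extended by `0` at `v₀`, takes equal values at the ends of every edge, so
  -- connectedness makes it zero.
  have hdet0 : (L ℝ).det ≠ 0 := by
    intro h0
    obtain ⟨z, hz, hz0⟩ := Matrix.exists_mulVec_eq_zero_iff.2 h0
    have h1 : (D ℝ).mulVec z = 0 := by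
      rw [← Matrix.conjTranspose_mul_self_mulVec_eq_zero,
        Matrix.conjTranspose_eq_transpose_of_trivial]
      exact hz0
    let z' : V → ℝ := fun v => if h : v = v₀ then 0 else z ⟨v, h⟩
    have hz' : (fun i : I => z' i) = z := by
      ext i
      simp [z', i.2]
    have h2 := hconn z' (fun c => by
      rw [← sub_eq_zero, ← hD ℝ z' (by simp [z']), hz', h1]; rfl)
    refine hz ?_
    ext i
    rw [← hz']
    exact (h2 i v₀).trans (by simp [z'])
  have hple : (p : ℝ) ≤ (L ℝ).det := by
    have h1 : 0 < (L ℝ).det := lt_of_le_of_ne hpsd.det_nonneg hdet0.symm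
    rw [← hdet] at h1 ⊢
    have h2 : 0 < (L ℤ).det := by exact_mod_cast h1
    exact_mod_cast Int.le_of_dvd h2 hdvd
  -- Rows of the incidence matrix sum to zero, so the sum of the entries of `L` restores the
  -- diagonal entry lost with `v₀`.
  have hsum : (L ℝ).trace + ∑ i, ∑ j, L ℝ i j = ∑ c, ∑ v, incidence ℝ F c v ^ 2 := by
    have h1 : (L ℝ).trace = ∑ c, ∑ i, D ℝ c i ^ 2 := by
      rw [Finset.sum_comm]
      simp [L, Matrix.trace, Matrix.mul_apply, sq]
    have h2 : ∑ i, ∑ j, L ℝ i j = ∑ c, (∑ i, D ℝ c i) ^ 2 := by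
      simp only [L, Matrix.mul_apply, Matrix.transpose_apply, sq, Finset.sum_mul_sum]
      rw [Finset.sum_comm]
      simp_rw [fun j => Finset.sum_comm (s := Finset.univ) (t := Finset.univ)
        (f := fun (i : I) (c : Ω) => D ℝ c i * D ℝ c j)]
      rw [Finset.sum_comm]
      exact Finset.sum_congr rfl fun c _ => Finset.sum_comm
    rw [h1, h2, ← Finset.sum_add_distrib]
    refine Finset.sum_congr rfl fun c _ => ?_
    have h3 : ∑ v, incidence ℝ F c v = 0 := by simp [incidence]
    rw [Fintype.sum_eq_add_sum_subtype_ne _ v₀] at h3 ⊢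
    have h4 : ∑ i, D ℝ c i = -incidence ℝ F c v₀ := eq_neg_of_add_eq_zero_right h3
    rw [h4, neg_sq, add_comm]
    rfl
  have hle : ∑ c, ∑ v, incidence ℝ F c v ^ 2 ≤ 2 * Fintype.card Ω := by
    calc _ ≤ ∑ c : Ω, (2 : ℝ) := Finset.sum_le_sum fun c _ => ?_
      _ = _ := by simp [mul_comm]
    calc ∑ v, incidence ℝ F c v ^ 2
        ≤ ∑ v, ((if F c true = v then 1 else 0) + (if F c false = v then 1 else 0)) :=
          Finset.sum_le_sum fun v _ => by
            simp only [incidence, Matrix.of_apply]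
            split_ifs <;> norm_num
      _ = 2 := by simp [Finset.sum_add_distrib]; norm_num
  have hmain := det_mul_card_pow_le_trace_add hpsd
  rw [hcardI, hsum] at hmain
  have hnn : 0 ≤ ∑ c, ∑ v, incidence ℝ F c v ^ 2 := by positivity
  have h3 : ((Fintype.card V * p * (Fintype.card V - 1) ^ (Fintype.card V - 1) : ℕ) : ℝ) ≤
      ((2 * Fintype.card Ω) ^ (Fintype.card V - 1) : ℕ) := by
    push_cast [hcardV]
    push_cast [hcardV] at hmain
    rw [sub_add_cancel] at hmain
    refine le_trans ?_ (hmain.trans (pow_le_pow_left₀ hnn hle _))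
    have : (0 : ℝ) ≤ (Fintype.card V - 1 : ℝ) := by
      rw [sub_nonneg]; exact_mod_cast hcardV
    gcongr
  exact_mod_cast h3

end

/-! ### Flows and potentials on the sphere. -/

theorem card_le_rank_add_one {K Ω V : Type*} [Field K] [Fintype Ω] [Fintype V]
    (M : Matrix Ω V K) (hM : ∀ y, M.mulVec y = 0 → ∀ v v', y v = y v') :
    Fintype.card V ≤ M.rank + 1 := by
  have h1 := M.mulVecLin.finrank_range_add_finrank_ker
  have h2 : Module.finrank K (LinearMap.ker M.mulVecLin) ≤ 1 := by
    have hle : LinearMap.ker M.mulVecLin ≤ Submodule.span K {fun _ => 1} := by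
      intro y hy
      rw [Submodule.mem_span_singleton]
      rcases isEmpty_or_nonempty V with h | ⟨⟨v₀⟩⟩
      · exact ⟨0, Subsingleton.elim _ _⟩
      · refine ⟨y v₀, ?_⟩
        ext v
        simpa using hM y (by simpa using hy) v₀ v
    exact (Submodule.finrank_mono hle).trans ((finrank_span_le_card _).trans (by simp))
  rw [Module.finrank_fintype_fun_eq_card] at h1
  have : M.rank = Module.finrank K (LinearMap.range M.mulVecLin) := rfl
  omega

/-- On the sphere, a flow that is balanced at all vertices of the dual graph is a potential
difference. -/
theorem exists_potential {K Ω V B : Type*} [Field K] [Fintype Ω] [Fintype V] [Fintype B]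
    [DecidableEq Ω] [DecidableEq V] [DecidableEq B] (F : Ω → Bool → V) (G : Ω → Bool → B) (η : Ω → K)
    (hη : ∀ c, η c ≠ 0)
    (hF : ∀ y : V → K, (∀ c, y (F c true) = y (F c false)) → ∀ v v', y v = y v')
    (hG : ∀ y : B → K, (∀ c, y (G c true) = y (G c false)) → ∀ v v', y v = y v')
    (hcard : Fintype.card V + Fintype.card B = Fintype.card Ω + 2)
    (horth : ∀ y : V → K, (incidence K G).transpose.mulVec
      (fun c => η c * (incidence K F).mulVec y c) = 0)
    (φ : Ω → K) (hφ : (incidence K G).transpose.mulVec φ = 0) :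
    ∃ y : V → K, φ = fun c => η c * (incidence K F).mulVec y c := by
  let T : Matrix Ω V K := Matrix.diagonal η * incidence K F
  have hT : ∀ y, T.mulVec y = fun c => η c * (incidence K F).mulVec y c := by
    intro y
    ext c
    rw [← Matrix.mulVec_mulVec, Matrix.mulVec_diagonal]
  have h1 : Fintype.card V ≤ T.rank + 1 := by
    refine card_le_rank_add_one T fun y hy => hF y fun c => ?_
    rw [hT] at hy
    have := congrFun hy c
    simpa [incidence_mulVec, hη, sub_eq_zero] using this
  have h2 : Fintype.card B ≤ (incidence K G).rank + 1 := by
    refine card_le_rank_add_one _ fun y hy => hG y fun c => ?_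
    have := congrFun hy c
    simpa [incidence_mulVec, sub_eq_zero] using this
  have h3 := (incidence K G).transpose.mulVecLin.finrank_range_add_finrank_ker
  rw [Module.finrank_fintype_fun_eq_card] at h3
  have h4 : Module.finrank K (LinearMap.range (incidence K G).transpose.mulVecLin) =
    (incidence K G).rank := (incidence K G).rank_transpose
  have h5 : T.rank = Module.finrank K (LinearMap.range T.mulVecLin) := rfl
  have hle : LinearMap.range T.mulVecLin ≤ LinearMap.ker (incidence K G).transpose.mulVecLin := by
    rintro _ ⟨y, rfl⟩
    rw [LinearMap.mem_ker, Matrix.mulVecLin_apply, Matrix.mulVecLin_apply, hT]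
    exact horth y
  -- The potential differences have dimension at least `|V| - 1`, the balanced flows at most `|Ω| -
  -- (|B| - 1)`; by Euler's formula `hcard` these numbers agree.
  have heq := Submodule.eq_of_le_of_finrank_le hle (by omega)
  have hmem : φ ∈ LinearMap.ker (incidence K G).transpose.mulVecLin := by
    rw [LinearMap.mem_ker, Matrix.mulVecLin_apply, hφ]
  rw [← heq] at hmem
  obtain ⟨y, hy⟩ := hmem
  refine ⟨y, ?_⟩
  rw [← hT, ← hy]
  rfl

/-! ### Numerical estimates. -/

/-- Bernoulli's inequality for `(1 - 1 / (n + 1)) ^ m`. -/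
theorem succ_pow_le_two_mul {m n : ℕ} (h : 2 * m ≤ n) : (n + 1) ^ m ≤ 2 * n ^ m := by
  have h1 : (1 : ℝ) / 2 ≤ (1 - 1 / ((n : ℝ) + 1)) ^ m := by
    have h2 : (-2 : ℝ) ≤ -(1 / ((n : ℝ) + 1)) := by
      have : 1 / ((n : ℝ) + 1) ≤ 1 := by
        rw [div_le_one (by positivity)]; linarith [(n.cast_nonneg : (0 : ℝ) ≤ n)]
      linarith
    have h3 := one_add_mul_le_pow h2 m
    rw [← sub_eq_add_neg] at h3
    refine le_trans ?_ h3
    have : (m : ℝ) * (1 / ((n : ℝ) + 1)) ≤ 1 / 2 := by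
      rw [mul_one_div, div_le_iff₀ (by positivity)]
      have : (2 : ℝ) * m ≤ n := by exact_mod_cast h
      linarith
    linarith
  have h4 : (1 : ℝ) - 1 / ((n : ℝ) + 1) = n / (n + 1) := by field_simp; ring
  rw [h4, div_pow, div_le_div_iff₀ (by norm_num) (by positivity)] at h1
  have : ((n : ℝ) + 1) ^ m ≤ 2 * n ^ m := by linarith
  exact_mod_cast this

/-- There is equality at `n = 2 * m`; each further step doubles the right side and at most doubles
the left side. -/
theorem two_mul_pow_le {m n : ℕ} (h : 2 * m ≤ n) : (2 * n) ^ m ≤ m ^ m * 2 ^ n := by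
  induction n, h using Nat.le_induction with
  | base =>
    rw [pow_mul, ← mul_pow]
    apply le_of_eq
    congr 1
    ring
  | succ n hn ih =>
    calc (2 * (n + 1)) ^ m = 2 ^ m * (n + 1) ^ m := by rw [mul_pow]
      _ ≤ 2 ^ m * (2 * n ^ m) := Nat.mul_le_mul_left _ (succ_pow_le_two_mul hn)
      _ = 2 * (2 * n) ^ m := by rw [mul_pow]; ring
      _ ≤ 2 * (m ^ m * 2 ^ n) := Nat.mul_le_mul_left _ ih
      _ = m ^ m * 2 ^ (n + 1) := by ring

theorem prime_ne_two_pow {p : ℕ} (hp : p.Prime) (hodd : p ≠ 2) (k : ℕ) : p ≠ 2 ^ k := fun h =>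
  hodd ((Nat.prime_dvd_prime_iff_eq hp Nat.prime_two).1 (hp.dvd_of_dvd_pow (dvd_of_eq h)))

/-- By `two_mul_pow_le` the hypothesis implies `V * p ≤ 2 ^ n`, which suffices for `V ≥ 4`. For `V =
2` and `V = 3` it reads `p ≤ n` and `3 * p ≤ n ^ 2`, whence the exceptions. -/
theorem small_or_lt_two_pow {p n V : ℕ} (hp : p.Prime) (hodd : p ≠ 2) (hV : 2 ≤ V)
    (hVn : 2 * V ≤ n + 2) (h : V * p * (V - 1) ^ (V - 1) ≤ (2 * n) ^ (V - 1)) :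
    (n = 3 ∧ p = 3) ∨ (n = 4 ∧ p ≤ 5) ∨ p < 2 ^ (n - 2) := by
  obtain ⟨m, rfl⟩ : ∃ m, V = m + 1 := ⟨V - 1, by omega⟩
  rw [Nat.add_sub_cancel] at h
  have h2 := hp.two_le
  have hmn : 2 * m ≤ n := by omega
  rcases (by omega : m = 1 ∨ m = 2 ∨ 3 ≤ m) with rfl | rfl | hm
  · have hpn : p ≤ n := by simp at h; omega
    rcases (by omega : n = 2 ∨ n = 3 ∨ n = 4 ∨ 5 ≤ n) with rfl | rfl | rfl | hn
    · omega
    · omega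
    · omega
    · right; right
      refine lt_of_le_of_lt hpn ?_
      clear hpn h hVn hmn
      induction n, hn using Nat.le_induction with
      | base => norm_num
      | succ n hn ih =>
        rw [show n + 1 - 2 = (n - 2) + 1 by omega, pow_succ]
        omega
  · have hpn : 3 * p ≤ n ^ 2 := by
      have : (2 * n) ^ 2 = 4 * n ^ 2 := by ring
      norm_num at h
      omega
    rcases (by omega : n = 4 ∨ n = 5 ∨ 6 ≤ n) with rfl | rfl | hn
    · omega
    · right; right
      -- Here `3 * p ≤ 25` gives only `p ≤ 2 ^ 3`, so equality has to be excluded.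
      have := prime_ne_two_pow hp hodd 3
      norm_num at *
      omega
    · right; right
      have : n ^ 2 < 3 * 2 ^ (n - 2) := by
        clear hpn h hVn hmn
        induction n, hn using Nat.le_induction with
        | base => norm_num
        | succ n hn ih =>
          have : 2 ^ (n + 1 - 2) = 2 ^ (n - 2) * 2 := by
            rw [← pow_succ]; congr 1; omega
          nlinarith
      omega
  · right; right
    have h3 : m ^ m * ((m + 1) * p) ≤ m ^ m * 2 ^ n := by
      calc m ^ m * ((m + 1) * p) = (m + 1) * p * m ^ m := by ring
        _ ≤ _ := h.trans (two_mul_pow_le hmn)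
    have h4 := Nat.le_of_mul_le_mul_left h3 (by positivity)
    have h5 : 2 ^ n = 4 * 2 ^ (n - 2) := by
      rw [show n = (n - 2) + 2 by omega, pow_add]
      simp; ring
    have h6 : 4 * p ≤ (m + 1) * p := Nat.mul_le_mul_right _ (by omega)
    exact lt_of_le_of_ne (by omega) (prime_ne_two_pow hp hodd _)

/-! ### Faces and checkerboard graphs of alternating codes. -/

/-- An injective self-map of a finite set permutes it, so `S.card` iterates exhaust the cycle of
`d`, wherever on the cycle they begin. Hence `faceOf` is constant along the boundary of a face. -/
theorem image_iterate_eq {α : Type*} [DecidableEq α] {f : α → α} (hf : Function.Injective f)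
    {S : Finset α} (hS : ∀ d ∈ S, f d ∈ S) {d : α} (hd : d ∈ S) :
    ((Finset.range S.card).image fun k => f^[k] (f d)) =
      (Finset.range S.card).image fun k => f^[k] d := by
  have hmem : ∀ k, f^[k] d ∈ S := by
    intro k
    induction k with
    | zero => exact hd
    | succ k ih => rw [Function.iterate_succ_apply']; exact hS _ ih
  obtain ⟨i, hi, j, hj, hne, heq⟩ := Finset.exists_ne_map_eq_of_card_lt_of_maps_to
    (s := Finset.range (S.card + 1)) (t := S) (by simp) (f := fun k => f^[k] d)
    (fun k _ => hmem k)
  obtain ⟨q, hq1, hq2, hq⟩ : ∃ q, 1 ≤ q ∧ q ≤ S.card ∧ f^[q] d = d := by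
    have key : ∀ i j, i < j → j < S.card + 1 → f^[i] d = f^[j] d →
        ∃ q, 1 ≤ q ∧ q ≤ S.card ∧ f^[q] d = d := by
      intro i j hij hj heq
      refine ⟨j - i, by omega, by omega, ?_⟩
      apply hf.iterate i
      rw [← Function.iterate_add_apply, show i + (j - i) = j by omega, heq]
    simp only [Finset.mem_range] at hi hj
    rcases lt_or_gt_of_ne hne with h | h
    · exact key i j h hj heq
    · exact key j i h hi heq.symm
  ext x
  simp only [Finset.mem_image, Finset.mem_range, ← Function.iterate_succ_apply]
  constructor
  · rintro ⟨k, hk, rfl⟩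
    by_cases hk' : k + 1 < S.card
    · exact ⟨k + 1, hk', rfl⟩
    · refine ⟨k + 1 - q, by omega, ?_⟩
      conv_rhs => rw [show k.succ = (k + 1 - q) + q by omega, Function.iterate_add_apply, hq]
  · rintro ⟨k, hk, rfl⟩
    obtain _ | k := k
    · exact ⟨q - 1, by omega, by rw [show (q - 1).succ = q by omega, hq]; rfl⟩
    · exact ⟨k, by omega, rfl⟩

/-- The face to the left of a directed edge, as the set of the directed edges on its boundary. -/
def faceOf (w : List Letter) (d : Letter × Bool) : Finset (Letter × Bool) :=
  (Finset.range (darts w).card).image fun k => (faceStep w)^[k] d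

/-- The passage at the end of a directed edge. -/
def dartEnd (w : List Letter) (d : Letter × Bool) : Letter :=
  if d.2 then w.formPerm d.1 else w.formPerm.symm d.1

/-- The same edge with the opposite direction. -/
def dartRev (w : List Letter) (d : Letter × Bool) : Letter × Bool := (dartEnd w d, !d.2)

theorem Letter.flip_flip (l : Letter) : l.flip.flip = l := by
  cases l; simp [Letter.flip]

theorem faceStep_eq (w : List Letter) (d : Letter × Bool) :
    faceStep w d = ((dartEnd w d).flip,
      d.2 == ((dartEnd w d).upper == (dartEnd w d).positive)) := rfl

theorem mem_darts {w : List Letter} {d : Letter × Bool} : d ∈ darts w ↔ d.1 ∈ w := by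
  simp [darts, Finset.mem_product]

theorem dartEnd_mem {w : List Letter} {d : Letter × Bool} (hd : d.1 ∈ w) : dartEnd w d ∈ w := by
  unfold dartEnd
  split_ifs
  · exact List.formPerm_apply_mem_of_mem hd
  · apply List.mem_of_formPerm_apply_mem
    simpa using hd

theorem dartEnd_dartRev (w : List Letter) (d : Letter × Bool) : dartEnd w (dartRev w d) = d.1 := by
  rcases d with ⟨l, _ | _⟩ <;> simp [dartRev, dartEnd]

theorem faceStep_injective (w : List Letter) : Function.Injective (faceStep w) := by
  intro d d' h
  rw [faceStep_eq, faceStep_eq, Prod.mk.injEq] at h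
  have h1 : dartEnd w d = dartEnd w d' := by
    rw [← (dartEnd w d).flip_flip, h.1, Letter.flip_flip]
  have h2 : d.2 = d'.2 := by
    have := h.2
    rw [h1] at this
    revert this
    cases d.2 <;> cases d'.2 <;> simp
  refine Prod.ext ?_ h2
  unfold dartEnd at h1
  rw [h2] at h1
  split_ifs at h1
  · exact w.formPerm.injective h1
  · exact w.formPerm.symm.injective h1

/-- The edge of `d` seen from the corner that follows it. -/
theorem dartRev_eq (w : List Letter) (d : Letter × Bool) : dartRev w d =
    ((faceStep w d).1.flip,
      (faceStep w d).2 == ((faceStep w d).1.upper == (faceStep w d).1.positive)) := by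
  rw [faceStep_eq]
  refine Prod.ext (Letter.flip_flip _).symm ?_
  simp only [dartRev, Letter.flip]
  cases d.2 <;> cases (dartEnd w d).upper <;> cases (dartEnd w d).positive <;> rfl

theorem faceStep_dartRev (w : List Letter) (d : Letter × Bool) : faceStep w (dartRev w d) =
    (d.1.flip, (!d.2) == (d.1.upper == d.1.positive)) := by
  rw [faceStep_eq, dartEnd_dartRev]
  rfl

theorem self_mem_faceOf {w : List Letter} {d : Letter × Bool} (hd : d.1 ∈ w) :
    d ∈ faceOf w d := by
  refine Finset.mem_image.2 ⟨0, ?_, rfl⟩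
  rw [Finset.mem_range]
  exact Finset.card_pos.2 ⟨d, mem_darts.2 hd⟩

theorem eq_of_formPerm_invariant {α β : Type*} [DecidableEq α] {w : List α} (hw : w.Nodup)
    (Z : α → β) (h : ∀ l ∈ w, Z l = Z (w.formPerm l)) {l l' : α} (hl : l ∈ w) (hl' : l' ∈ w) :
    Z l = Z l' := by
  have key : ∀ (i : ℕ) (hi : i < w.length), Z w[i] = Z (w[0]'(by omega)) := by
    intro i hi
    induction i with
    | zero => rfl
    | succ i ih =>
      rw [← ih (by omega), h _ (List.getElem_mem (by omega : i < w.length)),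
        List.formPerm_apply_getElem _ hw]
      simp only [Nat.mod_eq_of_lt hi]
  obtain ⟨i, hi, rfl⟩ := List.getElem_of_mem hl
  obtain ⟨j, hj, rfl⟩ := List.getElem_of_mem hl'
  rw [key i hi, key j hj]

/-- An alternating Gauss code. -/
structure IsAlternating (w : List Letter) : Prop where
  isGaussCode : IsGaussCode w
  upper_next : ∀ l ∈ w, (w.formPerm l).upper = !l.upper

namespace IsAlternating

variable {w : List Letter} (hw : IsAlternating w)
include hw

theorem faceStep_mem {d : Letter × Bool} (hd : d.1 ∈ w) : (faceStep w d).1 ∈ w :=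
  hw.isGaussCode.2.1 _ (dartEnd_mem hd)

theorem upper_dartEnd {d : Letter × Bool} (hd : d.1 ∈ w) : (dartEnd w d).upper = !d.1.upper := by
  have hm := dartEnd_mem hd
  unfold dartEnd at hm ⊢
  split_ifs at hm ⊢
  · exact hw.upper_next _ hd
  · have := hw.upper_next _ hm
    rw [Equiv.apply_symm_apply] at this
    rw [this, Bool.not_not]

/-- The end of an edge has the opposite height, and passing to the other strand flips it again. So
`upper` is constant on each face, which is the checkerboard coloring. -/
theorem upper_faceStep {d : Letter × Bool} (hd : d.1 ∈ w) :
    (faceStep w d).1.upper = d.1.upper := by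
  rw [faceStep_eq]
  simp [Letter.flip, hw.upper_dartEnd hd]

theorem faceOf_faceStep {d : Letter × Bool} (hd : d.1 ∈ w) :
    faceOf w (faceStep w d) = faceOf w d :=
  image_iterate_eq (faceStep_injective w)
    (fun _ h => mem_darts.2 (hw.faceStep_mem (mem_darts.1 h))) (mem_darts.2 hd)

theorem upper_of_mem_faceOf {d e : Letter × Bool} (hd : d.1 ∈ w) (he : e ∈ faceOf w d) :
    e.1.upper = d.1.upper := by
  obtain ⟨k, -, rfl⟩ := Finset.mem_image.1 he
  have : ∀ k, ((faceStep w)^[k] d).1 ∈ w ∧ ((faceStep w)^[k] d).1.upper = d.1.upper := by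
    intro k
    induction k with
    | zero => exact ⟨hd, rfl⟩
    | succ k ih =>
      rw [Function.iterate_succ_apply']
      exact ⟨hw.faceStep_mem ih.1, (hw.upper_faceStep ih.1).trans ih.2⟩
  exact (this k).2

/-- The checkerboard classes of faces are connected across crossings. -/
theorem faceOf_connected {α : Type*} (s : Bool) (Y : Finset (Letter × Bool) → α)
    (hY : ∀ l ∈ w, l.upper = s → Y (faceOf w (l, true)) = Y (faceOf w (l, false)))
    {d d' : Letter × Bool} (hd : d.1 ∈ w) (hd' : d'.1 ∈ w) (hs : d.1.upper = s)
    (hs' : d'.1.upper = s) : Y (faceOf w d) = Y (faceOf w d') := by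
  have hY' : ∀ l ∈ w, l.upper = s → ∀ β, Y (faceOf w (l, true)) = Y (faceOf w (l, β)) := by
    intro l hl hls β
    cases β
    · exact hY l hl hls
    · rfl
  -- Each crossing meets the class `s` in two opposite faces, on which `Y` agrees. Consecutive
  -- crossings share a face of this class, so `Z` is constant along the knot.
  let Z : Letter → α := fun l => Y (faceOf w (if l.upper = s then l else l.flip, true))
  have hZ : ∀ l ∈ w, Z l = Z (w.formPerm l) := by
    intro l hl
    have hk : w.formPerm l ∈ w := List.formPerm_apply_mem_of_mem hl
    have hku := hw.upper_next l hl
    by_cases hls : l.upper = s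
    · have hks : (w.formPerm l).upper ≠ s := by rw [hku, hls]; simp
      have hfs : (w.formPerm l).flip.upper = s := by simp [Letter.flip, hku, hls]
      simp only [Z, if_pos hls, if_neg hks]
      rw [← hw.faceOf_faceStep (d := (l, true)) hl, faceStep_eq]
      exact (hY' _ (hw.isGaussCode.2.1 _ hk) hfs _).symm
    · have hks : (w.formPerm l).upper = s := by
        rw [hku]; revert hls; cases l.upper <;> cases s <;> simp
      have hfs : l.flip.upper = s := by
        simp only [Letter.flip]; revert hls; cases l.upper <;> cases s <;> simp
      simp only [Z, if_neg hls, if_pos hks]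
      rw [hY' _ hk hks false, ← hw.faceOf_faceStep (d := (w.formPerm l, false)) hk, faceStep_eq]
      have : dartEnd w (w.formPerm l, false) = l := by simp [dartEnd]
      rw [this]
      exact hY' _ (hw.isGaussCode.2.1 _ hl) hfs _
  have h1 := eq_of_formPerm_invariant hw.isGaussCode.1 Z hZ hd hd'
  simp only [Z, hs, hs', if_true] at h1
  rw [hY' _ hd hs d.2, hY' _ hd' hs' d'.2] at h1
  exact h1

theorem sum_darts_faceStep {K : Type*} [AddCommMonoid K] (s : Bool) (Φ : Letter × Bool → K) :
    ∑ d ∈ (darts w).filter (fun d => d.1.upper = s), Φ (faceStep w d) =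
      ∑ d ∈ (darts w).filter (fun d => d.1.upper = s), Φ d := by
  have hmaps : ∀ d ∈ (darts w).filter (fun d => d.1.upper = s),
      faceStep w d ∈ (darts w).filter (fun d => d.1.upper = s) := by
    intro d hd
    rw [Finset.mem_filter, mem_darts] at hd ⊢
    exact ⟨hw.faceStep_mem hd.1, (hw.upper_faceStep hd.1).trans hd.2⟩
  refine Finset.sum_nbij (faceStep w) hmaps (faceStep_injective w).injOn ?_ (fun _ _ => rfl)
  exact Finset.surjOn_of_injOn_of_card_le _ hmaps (faceStep_injective w).injOn le_rfl

end IsAlternating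

/-- The faces of the checkerboard class `s`. -/
def facesOf (w : List Letter) (s : Bool) : Finset (Finset (Letter × Bool)) :=
  ((darts w).filter fun d => d.1.upper = s).image (faceOf w)

theorem IsAlternating.card_facesOf {w : List Letter} (hw : IsAlternating w) :
    (facesOf w true).card + (facesOf w false).card = (faces w).card := by
  rw [← Finset.card_union_of_disjoint]
  · congr 1
    unfold facesOf
    rw [← Finset.image_union]
    have : (darts w).filter (fun d => d.1.upper = true) ∪
        (darts w).filter (fun d => d.1.upper = false) = darts w := by
      ext d
      cases h : d.1.upper <;> simp [h]
    rw [this]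
    rfl
  · rw [Finset.disjoint_left]
    intro X h1 h2
    obtain ⟨d, hd, rfl⟩ := Finset.mem_image.1 h1
    obtain ⟨e, he, heq⟩ := Finset.mem_image.1 h2
    rw [Finset.mem_filter, mem_darts] at hd he
    have h3 := self_mem_faceOf hd.1
    rw [← heq] at h3
    have := hw.upper_of_mem_faceOf he.1 h3
    rw [hd.2, he.2] at this
    exact absurd this (by simp)

/-- The crossings of a code. -/
abbrev Crossings (w : List Letter) : Type := {c // c ∈ w.toFinset.image Letter.crossing}

/-- The faces of the checkerboard class `s`. -/
abbrev Region (w : List Letter) (s : Bool) : Type := {X // X ∈ facesOf w s}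

/-- `sgn` gives the signs of the crossings of `w`. -/
def IsSign (w : List Letter) (sgn : ℕ → Bool) : Prop := ∀ l ∈ w, l.positive = sgn l.crossing

theorem IsGaussCode.exists_isSign {w : List Letter} (hw : IsGaussCode w) :
    ∃ sgn, IsSign w sgn := by
  classical
  refine ⟨fun c => if h : ∃ l ∈ w, l.crossing = c then h.choose.positive else true, ?_⟩
  intro l hl
  have h : ∃ l' ∈ w, l'.crossing = l.crossing := ⟨l, hl, rfl⟩
  beta_reduce
  rw [dif_pos h]
  obtain ⟨h1, h2⟩ := h.choose_spec
  rcases hw.2.2 l hl _ h1 h2.symm with h | h <;> rw [h]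
  rfl

/-- The sign with which the crossing enters the boundary of the faces of the class `s`. -/
def crossingSign (K : Type*) [Ring K] (s σ : Bool) : K := if s == σ then -1 else 1

namespace IsAlternating

variable {w : List Letter} (hw : IsAlternating w) {sgn : ℕ → Bool} (hsgn : IsSign w sgn)
include hw hsgn

theorem letter_mem (s : Bool) (c : Crossings w) : (⟨c, s, sgn c⟩ : Letter) ∈ w := by
  obtain ⟨c, hc⟩ := c
  obtain ⟨l, hl, rfl⟩ := Finset.mem_image.1 hc
  rw [List.mem_toFinset] at hl
  have h1 := hsgn l hl
  by_cases hs : l.upper = s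
  · subst hs
    rw [← h1]
    exact hl
  · have : s = !l.upper := by revert hs; cases l.upper <;> cases s <;> simp
    subst this
    simp only [← h1]
    exact hw.isGaussCode.2.1 l hl

/-- The face of the class `s` to the left of an edge leaving the crossing `c`. -/
def region (s : Bool) (c : Crossings w) (β : Bool) : Region w s :=
  ⟨faceOf w (⟨c, s, sgn c⟩, β), Finset.mem_image_of_mem _
    (Finset.mem_filter.2 ⟨mem_darts.2 (hw.letter_mem hsgn s c), rfl⟩)⟩

theorem sum_darts {K : Type*} [AddCommMonoid K] (s : Bool) (Φ : Letter × Bool → K) :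
    ∑ d ∈ (darts w).filter (fun d => d.1.upper = s), Φ d =
      ∑ c : Crossings w, (Φ (⟨c, s, sgn c⟩, true) + Φ (⟨c, s, sgn c⟩, false)) := by
  have h1 : ∀ c : Crossings w, Φ (⟨c, s, sgn c⟩, true) + Φ (⟨c, s, sgn c⟩, false) =
      ∑ β : Bool, Φ (⟨c, s, sgn c⟩, β) := fun c => by simp
  simp_rw [h1]
  rw [← Fintype.sum_prod_type' (f := fun (c : Crossings w) (β : Bool) => Φ (⟨c, s, sgn c⟩, β))]
  symm
  refine Finset.sum_bij (fun x _ => (⟨x.1, s, sgn x.1⟩, x.2)) ?_ ?_ ?_ ?_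
  · rintro ⟨c, β⟩ -
    exact Finset.mem_filter.2 ⟨mem_darts.2 (hw.letter_mem hsgn s c), rfl⟩
  · rintro ⟨c, β⟩ - ⟨c', β'⟩ - h
    simp only [Prod.mk.injEq, Letter.mk.injEq] at h
    exact Prod.ext (Subtype.ext h.1.1) h.2
  · rintro ⟨⟨c, u, p⟩, β⟩ hd
    rw [Finset.mem_filter, mem_darts] at hd
    refine ⟨(⟨c, Finset.mem_image.2 ⟨_, List.mem_toFinset.2 hd.1, rfl⟩⟩, β),
      Finset.mem_univ _, ?_⟩
    have h2 := hsgn _ hd.1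
    have h3 := hd.2
    simp only at h2 h3
    subst h2 h3
    rfl
  · intros
    rfl

/-- Telescoping along the boundaries of the faces: the jumps of a function on directed edges at
the corners of the faces form a balanced flow. -/
theorem incidence_transpose_mulVec_eq_zero {K : Type*} [CommRing K] (s : Bool)
    (H T : Letter × Bool → K) (g : Crossings w → K)
    (hT : ∀ d : Letter × Bool, d.1 ∈ w → d.1.upper = s →
      T (faceStep w d) = H (faceStep w d) - H d)
    (hg : ∀ c : Crossings w, T (⟨c, s, sgn c⟩, true) = g c)
    (hg' : ∀ c : Crossings w, T (⟨c, s, sgn c⟩, false) = -g c) :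
    (incidence K (hw.region hsgn s)).transpose.mulVec g = 0 := by
  ext v
  have h1 : (incidence K (hw.region hsgn s)).transpose.mulVec g v =
      ∑ d ∈ (darts w).filter (fun d => d.1.upper = s), if faceOf w d = v.1 then T d else 0 := by
    rw [hw.sum_darts hsgn]
    simp only [Matrix.mulVec, dotProduct]
    refine Finset.sum_congr rfl fun c _ => ?_
    rw [hg, hg']
    simp only [Matrix.transpose_apply, incidence, Matrix.of_apply, region, Subtype.ext_iff]
    split_ifs <;> ring
  have h2 : ∀ d ∈ (darts w).filter (fun d => d.1.upper = s),
      (if faceOf w (faceStep w d) = v.1 then T (faceStep w d) else 0) =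
        (if faceOf w (faceStep w d) = v.1 then H (faceStep w d) else 0) -
          (if faceOf w d = v.1 then H d else 0) := by
    intro d hd
    rw [Finset.mem_filter, mem_darts] at hd
    rw [hT d hd.1 hd.2, hw.faceOf_faceStep hd.1]
    split_ifs <;> simp
  rw [h1, ← hw.sum_darts_faceStep s (fun d => if faceOf w d = v.1 then T d else 0),
    Finset.sum_congr rfl h2, Finset.sum_sub_distrib,
    hw.sum_darts_faceStep s (fun d => if faceOf w d = v.1 then H d else 0), sub_self]
  rfl

theorem region_surjective {s : Bool} (X : Region w s) :
    ∃ (c : Crossings w) (β : Bool), hw.region hsgn s c β = X := by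
  obtain ⟨X, hX⟩ := X
  obtain ⟨⟨l, β⟩, hd, rfl⟩ := Finset.mem_image.1 hX
  rw [Finset.mem_filter, mem_darts] at hd
  refine ⟨⟨l.crossing, Finset.mem_image.2 ⟨_, List.mem_toFinset.2 hd.1, rfl⟩⟩, β, ?_⟩
  apply Subtype.ext
  simp only [region, ← hsgn l hd.1, ← hd.2]

theorem region_connected {α : Type*} {s : Bool} (y : Region w s → α)
    (hy : ∀ c, y (hw.region hsgn s c true) = y (hw.region hsgn s c false)) (v v' : Region w s) :
    y v = y v' := by
  classical
  let Y : Finset (Letter × Bool) → α := fun X => if h : X ∈ facesOf w s then y ⟨X, h⟩ else y v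
  have hYy : ∀ X : Region w s, Y X.1 = y X := fun X => by simp [Y, X.2]
  obtain ⟨c, β, rfl⟩ := hw.region_surjective hsgn v
  obtain ⟨c', β', rfl⟩ := hw.region_surjective hsgn v'
  rw [← hYy, ← hYy]
  refine hw.faceOf_connected s Y ?_ (hw.letter_mem hsgn s c) (hw.letter_mem hsgn s c') rfl rfl
  intro l hl hls
  have h := hy ⟨l.crossing, Finset.mem_image.2 ⟨_, List.mem_toFinset.2 hl, rfl⟩⟩
  rw [← hYy, ← hYy] at h
  simpa only [region, ← hsgn l hl, ← hls] using h

/-- The potential differences of one checkerboard class are balanced flows for the other one. -/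
theorem potential_balanced {K : Type*} [CommRing K] (s : Bool) (y : Region w (!s) → K) :
    (incidence K (hw.region hsgn s)).transpose.mulVec (fun c => crossingSign K s (sgn c) *
      (incidence K (hw.region hsgn (!s))).mulVec y c) = 0 := by
  classical
  let Y : Finset (Letter × Bool) → K := fun X => if h : X ∈ facesOf w (!s) then y ⟨X, h⟩ else 0
  have hYy : ∀ X : Region w (!s), y X = Y X.1 := fun X => by simp [Y, X.2]
  -- `H d` is the value of `y` on the face across the edge `d`; around a face of class `s` these
  -- values return to their start, so the jumps at the corners cancel.
  refine hw.incidence_transpose_mulVec_eq_zero hsgn s (fun d => Y (faceOf w (dartRev w d)))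
    (fun e => Y (faceOf w (e.1.flip, (!e.2) == (e.1.upper == e.1.positive))) -
      Y (faceOf w (e.1.flip, e.2 == (e.1.upper == e.1.positive)))) _ ?_ ?_ ?_
  · intro d hd _
    rw [← dartRev_eq, ← faceStep_dartRev, hw.faceOf_faceStep]
    exact dartEnd_mem (hw.faceStep_mem hd)
  all_goals
    intro c
    rw [incidence_mulVec, hYy, hYy]
    simp only [region, Letter.flip, crossingSign]
    cases s <;> cases sgn c <;> simp

/-- A coloring of an alternating planar code gives a kernel vector of the Laplacian of a
checkerboard graph, hence a strong bound on the modulus. -/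
theorem small_or_lt_two_pow {p : ℕ} (hp : p.Prime) (hodd : p ≠ 2)
    (hplanar : (faces w).card = numCrossings w + 2) (hc : ClosedColoring (ZMod p) w) :
    (numCrossings w = 3 ∧ p = 3) ∨ (numCrossings w = 4 ∧ p ≤ 5) ∨
      p < 2 ^ (numCrossings w - 2) := by
  have := Fact.mk hp
  obtain ⟨f, col, hcol, l₁, hl₁, l₂, hl₂, hne⟩ := hw.isGaussCode.exists_edge_coloring hc
  have hcardΩ : Fintype.card (Crossings w) = numCrossings w := by
    simp [Crossings, numCrossings]
  have hcardV : ∀ s, Fintype.card (Region w s) = (facesOf w s).card := fun s => by simp [Region]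
  have hcard := hw.card_facesOf
  -- By Euler's formula the smaller class has at most `(n + 2) / 2` faces.
  obtain ⟨s, hs, hsle⟩ : ∃ s, (facesOf w s).card + (facesOf w (!s)).card = numCrossings w + 2 ∧
      2 * (facesOf w s).card ≤ numCrossings w + 2 := by
    rcases le_total (facesOf w true).card (facesOf w false).card with h | h
    · exact ⟨true, by simp only [Bool.not_true]; omega, by omega⟩
    · exact ⟨false, by simp only [Bool.not_false]; omega, by omega⟩
  let H : Letter × Bool → ZMod p := fun d => if d.2 then col d.1 else col (w.formPerm.symm d.1)
  have hHrev : ∀ d, H (dartRev w d) = H d := by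
    rintro ⟨l, _ | _⟩ <;> simp [H, dartRev, dartEnd]
  have hstep : ∀ l ∈ w, Step f l (H (l, false)) (H (l, true)) := by
    intro l hl
    have := hcol (w.formPerm.symm l) (List.mem_of_formPerm_apply_mem (by simpa using hl))
    simpa [H] using this
  have hover : ∀ (c : Crossings w) (β : Bool), H (⟨c, true, sgn c⟩, β) = f c := by
    intro c β
    have := hstep _ (hw.letter_mem hsgn true c)
    simp only [Step, if_true] at this
    cases β
    · exact this.1
    · exact this.2
  have hunder : ∀ c : Crossings w,
      H (⟨c, false, sgn c⟩, false) + H (⟨c, false, sgn c⟩, true) = 2 * f c := by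
    intro c
    have := hstep _ (hw.letter_mem hsgn false c)
    simpa only [Step, Bool.false_eq_true, if_false] using this
  -- The two under-edges differ from the over-arc by opposite amounts `±φ c`. Up to sign these are
  -- the jumps of the edge colors at the corners of both classes, so both `g true` and `g false` are
  -- balanced.
  let φ : Crossings w → ZMod p := fun c => H (⟨c, false, sgn c⟩, true) - f c
  let g : Bool → Crossings w → ZMod p := fun s c => if s && sgn c then -φ c else φ c
  have hg : ∀ s, (incidence (ZMod p) (hw.region hsgn s)).transpose.mulVec (g s) = 0 := by
    intro s
    refine hw.incidence_transpose_mulVec_eq_zero hsgn s H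
      (fun e => H e - H (e.1.flip, e.2 == (e.1.upper == e.1.positive))) _ ?_ ?_ ?_
    · intro d hd _
      rw [← dartRev_eq, hHrev]
    all_goals
      intro c
      have h1 := hover c
      have h2 := hunder c
      simp only [Letter.flip, g, φ]
      cases s <;> cases hσ : sgn c <;> rw [hσ] at h1 h2 <;> simp [h1] <;>
        first | linear_combination h2 | linear_combination -h2
  obtain ⟨y, hy⟩ := exists_potential (hw.region hsgn s) (hw.region hsgn (!s))
    (fun c => crossingSign (ZMod p) (!s) (sgn c))
    (fun c => by unfold crossingSign; split_ifs <;> simp)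
    (hw.region_connected hsgn) (hw.region_connected hsgn) (by rw [hcardV, hcardV, hcardΩ, hs])
    (fun y => by
      have h : ∀ (t : Bool) (ht : t = s) (y : Region w t → ZMod p),
          (incidence (ZMod p) (hw.region hsgn (!s))).transpose.mulVec (fun c =>
            crossingSign (ZMod p) (!s) (sgn c) *
              (incidence (ZMod p) (hw.region hsgn t)).mulVec y c) = 0 := by
        intro t ht
        obtain rfl : t = !!s := by simp [ht]
        exact hw.potential_balanced hsgn (!s)
      exact h s rfl y) (g (!s)) (hg _)
  have hlap : (incidence (ZMod p) (hw.region hsgn s)).transpose.mulVec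
      ((incidence (ZMod p) (hw.region hsgn s)).mulVec y) = 0 := by
    -- The crossing signs turn `g (!s)` into `g s` up to a global sign, so the gradient of `y` is
    -- itself balanced for the class `s`.
    have h1 : (incidence (ZMod p) (hw.region hsgn s)).mulVec y =
        (if s then -1 else 1 : ZMod p) • g s := by
      ext c
      have h2 := congrFun hy c
      simp only [g, crossingSign] at h2
      simp only [Pi.smul_apply, smul_eq_mul, g]
      cases s <;> cases hσ : sgn c <;> simp [hσ] at h2 ⊢ <;> simp [h2]
    rw [h1, Matrix.mulVec_smul, hg, smul_zero]
  -- A constant potential would give `φ = 0`, so no underpassage would change the color.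
  have hnonconst : ∃ v v', y v ≠ y v' := by
    by_contra hcon
    push Not at hcon
    have hφ : ∀ c, φ c = 0 := by
      intro c
      have h2 := congrFun hy c
      beta_reduce at h2
      rw [incidence_mulVec, hcon _ (hw.region hsgn s c false), sub_self, mul_zero] at h2
      simp only [g] at h2
      split_ifs at h2
      · exact neg_eq_zero.1 h2
      · exact h2
    refine hne (eq_of_formPerm_invariant hw.isGaussCode.1 col ?_ hl₁ hl₂)
    intro l hl
    have hk : w.formPerm l ∈ w := List.formPerm_apply_mem_of_mem hl
    have h3 := hcol l hl
    set k := w.formPerm l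
    unfold Step at h3
    split_ifs at h3 with hu
    · rw [h3.1, h3.2]
    · have h4 := hφ ⟨k.crossing, Finset.mem_image.2 ⟨_, List.mem_toFinset.2 hk, rfl⟩⟩
      have h5 : (⟨k.crossing, false, sgn k.crossing⟩ : Letter) = k := by
        rw [← hsgn k hk]
        simp at hu
        rw [← hu]
      simp only [φ, h5, H, if_true] at h4
      linear_combination h3 - 2 * h4
  have hV2 : 2 ≤ Fintype.card (Region w s) := by
    obtain ⟨v, v', h⟩ := hnonconst
    exact Fintype.one_lt_card_iff.2 ⟨v, v', fun h' => h (by rw [h'])⟩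
  have hmain := card_mul_prime_mul_le hp (hw.region hsgn s) (hw.region_connected hsgn) y hlap
    hnonconst
  rw [hcardΩ] at hmain
  exact KnotTheory.small_or_lt_two_pow hp hodd hV2 (by rw [hcardV]; exact hsle) hmain

end IsAlternating

theorem KnotDiagram.small_or_lt_two_pow {p : ℕ} (hp : p.Prime) (hodd : p ≠ 2) (D : KnotDiagram)
    (hc : ClosedColoring (ZMod p) D.word) :
    (IsAlternating D.word ∧ (numCrossings D.word = 3 ∧ p = 3 ∨ numCrossings D.word = 4 ∧ p ≤ 5)) ∨
      p < 2 ^ (numCrossings D.word - 2) := by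
  rcases D.isGaussCode.lt_two_pow_or_alternating hp hodd hc with h | h
  · exact Or.inr h
  · have hw : IsAlternating D.word := ⟨D.isGaussCode, h⟩
    obtain ⟨sgn, hsgn⟩ := D.isGaussCode.exists_isSign
    have hpl : (faces D.word).card = numCrossings D.word + 2 := by
      rcases D.isPlanar with h0 | h0
      · obtain ⟨f, x, -, l, hl, -⟩ := hc
        simp [h0] at hl
      · exact h0
    rcases hw.small_or_lt_two_pow hsgn hp hodd hpl hc with h | h | h
    · exact Or.inl ⟨hw, Or.inl h⟩
    · exact Or.inl ⟨hw, Or.inr h⟩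
    · exact Or.inr h

/-! ### Renaming and rotating diagrams. -/

theorem formPerm_map {α β : Type*} [DecidableEq α] [DecidableEq β] {g : α → β}
    (hg : Function.Injective g) (w : List α) (x : α) :
    (w.map g).formPerm (g x) = g (w.formPerm x) := by
  induction w with
  | nil => simp
  | cons a w ih =>
    cases w with
    | nil => simp
    | cons b w =>
      rw [List.map_cons, List.map_cons, List.formPerm_cons_cons, List.formPerm_cons_cons,
        Equiv.Perm.mul_apply, Equiv.Perm.mul_apply, ← List.map_cons, ih, hg.swap_apply]

theorem Letter.relabel_injective (g : Equiv.Perm ℕ) : Function.Injective (Letter.relabel g) := by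
  rintro ⟨a, b, c⟩ ⟨a', b', c'⟩ h
  simpa [Letter.relabel] using h

theorem faceStep_relabel (g : Equiv.Perm ℕ) (w : List Letter) (d : Letter × Bool) :
    faceStep (w.map (Letter.relabel g)) (Prod.map (Letter.relabel g) id d) =
      Prod.map (Letter.relabel g) id (faceStep w d) := by
  have h : dartEnd (w.map (Letter.relabel g)) (Prod.map (Letter.relabel g) id d) =
      Letter.relabel g (dartEnd w d) := by
    unfold dartEnd
    rcases d with ⟨l, _ | _⟩
    · simp only [Prod.map_apply, id_eq, Bool.false_eq_true, if_false]
      rw [Equiv.symm_apply_eq, formPerm_map (Letter.relabel_injective g), Equiv.apply_symm_apply]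
    · simp [formPerm_map (Letter.relabel_injective g)]
  rw [faceStep_eq, faceStep_eq, h]
  rfl

theorem numCrossings_relabel (g : Equiv.Perm ℕ) (w : List Letter) :
    numCrossings (w.map (Letter.relabel g)) = numCrossings w := by
  unfold numCrossings
  conv_rhs => rw [← Finset.card_image_of_injective _ g.injective]
  congr 1
  ext c
  simp [Letter.relabel]

theorem faces_relabel (g : Equiv.Perm ℕ) (w : List Letter) :
    faces (w.map (Letter.relabel g)) =
      (faces w).image (Finset.image (Prod.map (Letter.relabel g) id)) := by
  have hdarts : darts (w.map (Letter.relabel g)) =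
      (darts w).image (Prod.map (Letter.relabel g) id) := by
    ext ⟨l, β⟩
    simp [darts]
  have hinj : Function.Injective (Prod.map (Letter.relabel g) (id : Bool → Bool)) :=
    (Letter.relabel_injective g).prodMap Function.injective_id
  have hit : ∀ k d, (faceStep (w.map (Letter.relabel g)))^[k]
      (Prod.map (Letter.relabel g) id d) =
        Prod.map (Letter.relabel g) id ((faceStep w)^[k] d) := by
    intro k d
    induction k with
    | zero => rfl
    | succ k ih => rw [Function.iterate_succ_apply', Function.iterate_succ_apply', ih,
        faceStep_relabel]
  unfold faces
  rw [hdarts, Finset.card_image_of_injective _ hinj, Finset.image_image, Finset.image_image]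
  refine Finset.image_congr fun d _ => ?_
  simp only [Function.comp_apply, hit, Finset.image_image]
  rfl

theorem IsPlanar.relabel {w : List Letter} (h : IsPlanar w) (g : Equiv.Perm ℕ) :
    IsPlanar (w.map (Letter.relabel g)) := by
  rcases h with rfl | h
  · exact Or.inl rfl
  · right
    have hinj : Function.Injective (Prod.map (Letter.relabel g) (id : Bool → Bool)) :=
      (Letter.relabel_injective g).prodMap Function.injective_id
    rw [faces_relabel, Finset.card_image_of_injective _ (Finset.image_injective hinj), h,
      numCrossings_relabel]

theorem IsPlanar.rotate {u v : List Letter} (hn : (u ++ v).Nodup) (h : IsPlanar (u ++ v)) :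
    IsPlanar (v ++ u) := by
  rcases h with h | h
  · left
    simp_all
  · right
    rw [← numCrossings_perm (List.perm_append_comm (l₁ := u) (l₂ := v)), ← h]
    have h1 : (v ++ u).toFinset = (u ++ v).toFinset :=
      List.toFinset_eq_of_perm _ _ List.perm_append_comm
    have h2 : (v ++ u).formPerm = (u ++ v).formPerm :=
      (List.formPerm_eq_of_isRotated hn List.isRotated_append).symm
    unfold faces faceStep darts
    rw [h1, h2]

theorem IsGaussCode.relabel {w : List Letter} (h : IsGaussCode w) (g : Equiv.Perm ℕ) :
    IsGaussCode (w.map (Letter.relabel g)) := by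
  refine ⟨h.1.map (Letter.relabel_injective g), ?_, ?_⟩
  · intro l hl
    obtain ⟨k, hk, rfl⟩ := List.mem_map.1 hl
    exact List.mem_map.2 ⟨k.flip, h.2.1 k hk, rfl⟩
  · intro l hl l' hl' heq
    obtain ⟨k, hk, rfl⟩ := List.mem_map.1 hl
    obtain ⟨k', hk', rfl⟩ := List.mem_map.1 hl'
    rcases h.2.2 k hk k' hk' (g.injective heq) with rfl | rfl
    · exact Or.inl rfl
    · exact Or.inr rfl

theorem KnotDiagram.exists_rotate (D : KnotDiagram) {u v : List Letter} (h : D.word = u ++ v) :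
    ∃ D' : KnotDiagram, D'.word = v ++ u ∧ D'.knot = D.knot := by
  have hg := D.isGaussCode
  have hp := D.isPlanar
  rw [h] at hg hp
  refine ⟨⟨v ++ u, hg.perm List.perm_append_comm, hp.rotate hg.1⟩, rfl, Quot.sound ?_⟩
  rw [h]
  exact Move.rotate v u

theorem KnotDiagram.exists_relabel (D : KnotDiagram) (g : Equiv.Perm ℕ) :
    ∃ D' : KnotDiagram, D'.word = D.word.map (Letter.relabel g) ∧ D'.knot = D.knot := by
  refine ⟨⟨_, D.isGaussCode.relabel g, D.isPlanar.relabel g⟩, rfl, Eq.symm (Quot.sound ?_)⟩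
  exact Move.relabel g D.word

theorem IsAlternating.length {w : List Letter} (hw : IsAlternating w) :
    w.length = 2 * numCrossings w := by
  have h1 := hw.isGaussCode.card_filter_upper true
  have h2 := hw.isGaussCode.card_filter_upper false
  have h3 := Finset.card_filter_add_card_filter_not (s := w.toFinset) (fun l => l.upper = true)
  simp only [Bool.not_eq_true] at h3
  rw [h1, h2, List.toFinset_card_of_nodup hw.isGaussCode.1] at h3
  omega

theorem IsAlternating.getElem_succ {w : List Letter} (hw : IsAlternating w) (i : ℕ)
    (hi : i + 1 < w.length) : w[i + 1].upper = !w[i].upper := by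
  have h := hw.upper_next w[i] (List.getElem_mem _)
  rw [List.formPerm_apply_getElem _ hw.isGaussCode.1] at h
  simpa only [Nat.mod_eq_of_lt hi] using h

/-- An alternating diagram can be rotated so that it starts with an upper passage. -/
theorem KnotDiagram.exists_upper_head (D : KnotDiagram) (hD : IsAlternating D.word) :
    ∃ D' : KnotDiagram, IsAlternating D'.word ∧ D'.knot = D.knot ∧ D'.word.Perm D.word ∧
      ∀ l ∈ D'.word.head?, l.upper = true := by
  cases hw : D.word with
  | nil => exact ⟨D, hD, rfl, by rw [hw], by simp [hw]⟩
  | cons l m =>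
    cases hu : l.upper
    · obtain ⟨D', h1, h2⟩ := D.exists_rotate (u := [l]) (v := m) (by simp [hw])
      have hrot : [l] ++ m ~r m ++ [l] := List.isRotated_append
      have hn := hD.isGaussCode.1
      have hfp : D'.word.formPerm = D.word.formPerm := by
        rw [h1, hw]
        rw [hw] at hn
        exact (List.formPerm_eq_of_isRotated hn hrot).symm
      have hperm : D'.word.Perm D.word := by
        rw [h1, hw]
        exact hrot.perm.symm
      refine ⟨D', ⟨D'.isGaussCode, fun k hk => ?_⟩, h2, by rwa [← hw], ?_⟩
      · rw [hfp]
        exact hD.upper_next k (hperm.mem_iff.1 hk)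
      · have hlen := hD.length
        rw [hw] at hlen
        rw [h1]
        cases m with
        | nil => simp at hlen; omega
        | cons k m =>
          have := hD.getElem_succ 0 (by rw [hw]; simp)
          simp only [hw] at this
          simpa [hu] using this
    · exact ⟨D, hD, rfl, by rw [hw], by simp [hw, hu]⟩

theorem exists_perm_fin {n : ℕ} (a b : Fin n → ℕ) (ha : Function.Injective a)
    (hb : Function.Injective b) : ∃ g : Equiv.Perm ℕ, ∀ i, g (a i) = b i := by
  have := Equiv.Perm.isMultiplyPretransitive ℕ n
  obtain ⟨g, hg⟩ := MulAction.exists_smul_eq (Equiv.Perm ℕ) (⟨a, ha⟩ : Fin n ↪ ℕ) ⟨b, hb⟩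
  exact ⟨g, fun i => DFunLike.congr_fun hg i⟩

/-! ### Diagrams with three and four crossings. -/

/-- The vector lists the arc colors in the order of travel, the first shifted to `0`; `i`, `j`, `k`
are the over-arcs at the successive underpassages. A non-constant coloring determines them. -/
theorem coloring_three : ∀ i j k : Fin 3, i ≠ j → i ≠ k → j ≠ k → ∀ b c : ZMod 3,
    (![0, b, c] 0 + ![0, b, c] 1 = 2 * ![0, b, c] i ∧ ![0, b, c] 1 + ![0, b, c] 2 = 2 * ![0, b, c] j ∧
      ![0, b, c] 2 + ![0, b, c] 0 = 2 * ![0, b, c] k) →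
    (b = 0 ∧ c = 0) ∨ (i = 2 ∧ j = 0 ∧ k = 1) := by
  decide +kernel

-- The two surviving patterns are the crossing sequences of `word4` and `word4'`.
set_option synthInstance.maxSize 2000 in
set_option synthInstance.maxHeartbeats 400000 in
theorem coloring_four : ∀ i j k l : Fin 4, i ≠ j ∧ i ≠ k ∧ i ≠ l ∧ j ≠ k ∧ j ≠ l ∧ k ≠ l →
    ∀ b c d : ZMod 5,
    (![0, b, c, d] 0 + ![0, b, c, d] 1 = 2 * ![0, b, c, d] i ∧
      ![0, b, c, d] 1 + ![0, b, c, d] 2 = 2 * ![0, b, c, d] j ∧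
      ![0, b, c, d] 2 + ![0, b, c, d] 3 = 2 * ![0, b, c, d] k ∧
      ![0, b, c, d] 3 + ![0, b, c, d] 0 = 2 * ![0, b, c, d] l) →
    (b = 0 ∧ c = 0 ∧ d = 0) ∨ (i = 3 ∧ j = 0 ∧ k = 1 ∧ l = 2) ∨
      (i = 2 ∧ j = 3 ∧ k = 0 ∧ l = 1) := by
  decide +kernel

/-- The alternating three-crossing word with crossing signs `s₁`, `s₂`, `s₃`. -/
def word3 (s₁ s₂ s₃ : Bool) : List Letter :=
  [⟨1, true, s₁⟩, ⟨3, false, s₃⟩, ⟨2, true, s₂⟩, ⟨1, false, s₁⟩, ⟨3, true, s₃⟩, ⟨2, false, s₂⟩]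

/-- The alternating four-crossing word with crossing signs `s₁`, `s₂`, `s₃`, `s₄`. -/
def word4 (s₁ s₂ s₃ s₄ : Bool) : List Letter :=
  [⟨1, true, s₁⟩, ⟨4, false, s₄⟩, ⟨2, true, s₂⟩, ⟨1, false, s₁⟩,
    ⟨3, true, s₃⟩, ⟨2, false, s₂⟩, ⟨4, true, s₄⟩, ⟨3, false, s₃⟩]

/-- The same word as `word4` with the opposite orientation. -/
def word4' (s₁ s₂ s₃ s₄ : Bool) : List Letter :=
  [⟨1, true, s₁⟩, ⟨3, false, s₃⟩, ⟨2, true, s₂⟩, ⟨4, false, s₄⟩,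
    ⟨3, true, s₃⟩, ⟨1, false, s₁⟩, ⟨4, true, s₄⟩, ⟨2, false, s₂⟩]

-- The number of faces decides which sign patterns are realized on the sphere.
set_option maxRecDepth 100000 in
theorem planar_word3 : ∀ s₁ s₂ s₃, IsPlanar (word3 s₁ s₂ s₃) → s₂ = s₁ ∧ s₃ = s₁ := by
  decide +kernel

set_option maxRecDepth 100000 in
theorem planar_word4 : ∀ s₁ s₂ s₃ s₄, IsPlanar (word4 s₁ s₂ s₃ s₄) →
    s₂ = !s₁ ∧ s₃ = s₁ ∧ s₄ = !s₁ := by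
  decide +kernel

set_option maxRecDepth 100000 in
theorem planar_word4' : ∀ s₁ s₂ s₃ s₄, IsPlanar (word4' s₁ s₂ s₃ s₄) →
    s₂ = !s₁ ∧ s₃ = s₁ ∧ s₄ = !s₁ := by
  decide +kernel

set_option maxRecDepth 100000 in
theorem isPlanar_word4 : ∀ s, IsPlanar (word4 s (!s) s (!s)) := by
  decide +kernel

theorem KnotDiagram.knot_congr {D D' : KnotDiagram} (h : D.word = D'.word) : D.knot = D'.knot := by
  cases D; cases D'
  simp only at h
  subst h
  rfl

theorem KnotDiagram.knot_of_word3 {D : KnotDiagram} {s₁ s₂ s₃ : Bool}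
    (h : D.word = word3 s₁ s₂ s₃) : D.knot = trefoil true ∨ D.knot = trefoil false := by
  have hp := D.isPlanar
  rw [h] at hp
  obtain ⟨rfl, rfl⟩ := planar_word3 _ _ _ hp
  obtain ⟨D', h1, h2⟩ := D.exists_relabel (Equiv.swap 2 3)
  have h3 : D.knot = trefoil s₃ := by
    rw [← h2]
    apply KnotDiagram.knot_congr
    rw [h1, h]
    clear h hp h1
    revert s₃
    decide
  cases s₃
  · exact Or.inr h3
  · exact Or.inl h3

theorem KnotDiagram.knot_of_word4 {D : KnotDiagram} {s₁ s₂ s₃ s₄ : Bool}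
    (h : D.word = word4 s₁ s₂ s₃ s₄) : D.knot = figureEight := by
  have hp := D.isPlanar
  rw [h] at hp
  obtain ⟨rfl, rfl, rfl⟩ := planar_word4 _ _ _ _ hp
  have key : ∀ D : KnotDiagram, D.word = word4 false true false true → D.knot = figureEight := by
    intro D h
    obtain ⟨D', h1, h2⟩ := D.exists_relabel (List.formPerm [2, 3, 4])
    rw [← h2]
    apply KnotDiagram.knot_congr
    rw [h1, h]
    decide
  cases s₃
  · exact key D h
  -- A rotation by two letters and a renaming exchange the two sign patterns.
  · obtain ⟨D₁, h1, h2⟩ := D.exists_rotate (u := (word4 true false true false).take 2)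
      (v := (word4 true false true false).drop 2) h
    obtain ⟨D₂, h3, h4⟩ := D₁.exists_relabel (List.formPerm [4, 3, 2, 1])
    rw [← h2, ← h4]
    apply key
    rw [h3, h1]
    decide

theorem KnotDiagram.knot_of_word4' {D : KnotDiagram} {s₁ s₂ s₃ s₄ : Bool}
    (h : D.word = word4' s₁ s₂ s₃ s₄) : D.knot = figureEight := by
  have hp := D.isPlanar
  rw [h] at hp
  obtain ⟨rfl, rfl, rfl⟩ := planar_word4' _ _ _ _ hp
  -- The reverse of `D.word` is, up to renaming and rotation, `word4` with the opposite signs.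
  let D₁ : KnotDiagram := ⟨word4 (!s₃) s₃ (!s₃) s₃, by clear h hp; revert s₃; decide,
    by simpa using isPlanar_word4 (!s₃)⟩
  obtain ⟨D₂, h1, h2⟩ := D₁.exists_relabel (Equiv.swap 1 4 * Equiv.swap 2 3)
  obtain ⟨D₃, h3, h4⟩ := D₂.exists_rotate (u := D₂.word.take 7) (v := D₂.word.drop 7) (by simp)
  have h5 : D₃.word = D.word.reverse := by
    rw [h3, h1, h]
    simp only [D₁]
    clear h hp h1 h3
    cases s₃ <;> decide
  have h6 : D.knot = D₃.knot := by
    refine Quot.sound ?_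
    rw [h5]
    exact Move.reverse _
  rw [h6, h4, h2]
  exact knot_of_word4 rfl

theorem KnotDiagram.knot_of_three {D : KnotDiagram} {x y z : ℕ} {s₁ s₂ s₃ t₁ t₂ t₃ : Bool}
    (h : D.word = [⟨1, true, s₁⟩, ⟨x, false, t₁⟩, ⟨2, true, s₂⟩, ⟨y, false, t₂⟩, ⟨3, true, s₃⟩,
      ⟨z, false, t₃⟩]) (hc : ClosedColoring (ZMod 3) D.word) :
    D.knot = trefoil true ∨ D.knot = trefoil false := by
  have hg := D.isGaussCode
  rw [h] at hg hc
  have hmem : ∀ u t, (⟨u, false, t⟩ : Letter) ∈ D.word →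
      ∃ i : Fin 3, u = i + 1 ∧ t = ![s₁, s₂, s₃] i := by
    intro u t hu
    rw [h] at hu
    have := hg.2.1 _ hu
    simp [Letter.flip] at this
    rcases this with ⟨rfl, rfl⟩ | ⟨rfl, rfl⟩ | ⟨rfl, rfl⟩
    · exact ⟨0, rfl, rfl⟩
    · exact ⟨1, rfl, rfl⟩
    · exact ⟨2, rfl, rfl⟩
  obtain ⟨i, rfl, rfl⟩ := hmem x t₁ (by simp [h])
  obtain ⟨j, rfl, rfl⟩ := hmem y t₂ (by simp [h])
  obtain ⟨k, rfl, rfl⟩ := hmem z t₃ (by simp [h])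
  have hn := hg.1
  simp only [List.nodup_cons, List.mem_cons, Letter.mk.injEq] at hn
  have hij : i ≠ j := by rintro rfl; simp at hn
  have hik : i ≠ k := by rintro rfl; simp at hn
  have hjk : j ≠ k := by rintro rfl; simp at hn
  obtain ⟨f, a, hf, hne⟩ := hc
  have hcol : ∀ i : Fin 3, ![0, f 2 - f 1, f 3 - f 1] i = f (i + 1) - f 1 := by
    intro i; fin_cases i <;> simp
  have h3 := coloring_three i j k hij hik hjk (f 2 - f 1) (f 3 - f 1)
  simp only [hcol] at h3
  simp only [Path, Step, if_true, Bool.false_eq_true, if_false] at hf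
  obtain ⟨z1, ⟨ha, e1⟩, z2, h4, z3, ⟨e2, e3⟩, z4, h5, z5, ⟨e4, e5⟩, z6, h6, e8⟩ := hf
  rw [e1, e2] at h4
  rw [e3, e4] at h5
  rw [e5, e8] at h6
  rcases h3 ⟨by simp; linear_combination h4, by simp; linear_combination h5,
    by simp; linear_combination h6 - ha⟩ with h7 | ⟨rfl, rfl, rfl⟩
  · exfalso
    obtain ⟨l, hl, hne⟩ := hne
    apply hne
    have h8 : ∀ i : Fin 3, f (i + 1) = a := by
      intro i
      have := hcol i
      rw [h7.1, h7.2] at this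
      rw [ha]
      fin_cases i <;> simp at this ⊢ <;> linear_combination -this
    have h81 := h8 0
    have h82 := h8 1
    have h83 := h8 2
    simp at h81 h82 h83
    simp at hl
    rcases hl with rfl | rfl | rfl | rfl | rfl | rfl <;> first | exact h8 _ | assumption
  · exact knot_of_word3 h

theorem KnotDiagram.knot_of_four {D : KnotDiagram} {x y z u : ℕ}
    {s₁ s₂ s₃ s₄ t₁ t₂ t₃ t₄ : Bool}
    (h : D.word = [⟨1, true, s₁⟩, ⟨x, false, t₁⟩, ⟨2, true, s₂⟩, ⟨y, false, t₂⟩, ⟨3, true, s₃⟩,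
      ⟨z, false, t₃⟩, ⟨4, true, s₄⟩, ⟨u, false, t₄⟩]) (hc : ClosedColoring (ZMod 5) D.word) :
    D.knot = figureEight := by
  have hg := D.isGaussCode
  rw [h] at hg hc
  have hmem : ∀ u t, (⟨u, false, t⟩ : Letter) ∈ D.word →
      ∃ i : Fin 4, u = i + 1 ∧ t = ![s₁, s₂, s₃, s₄] i := by
    intro u t hu
    rw [h] at hu
    have := hg.2.1 _ hu
    simp [Letter.flip] at this
    rcases this with ⟨rfl, rfl⟩ | ⟨rfl, rfl⟩ | ⟨rfl, rfl⟩ | ⟨rfl, rfl⟩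
    · exact ⟨0, rfl, rfl⟩
    · exact ⟨1, rfl, rfl⟩
    · exact ⟨2, rfl, rfl⟩
    · exact ⟨3, rfl, rfl⟩
  obtain ⟨i, rfl, rfl⟩ := hmem x t₁ (by simp [h])
  obtain ⟨j, rfl, rfl⟩ := hmem y t₂ (by simp [h])
  obtain ⟨k, rfl, rfl⟩ := hmem z t₃ (by simp [h])
  obtain ⟨m, rfl, rfl⟩ := hmem u t₄ (by simp [h])
  have hn := hg.1
  simp only [List.nodup_cons, List.mem_cons, Letter.mk.injEq] at hn
  have hne' : i ≠ j ∧ i ≠ k ∧ i ≠ m ∧ j ≠ k ∧ j ≠ m ∧ k ≠ m := by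
    refine ⟨?_, ?_, ?_, ?_, ?_, ?_⟩ <;> · rintro rfl; simp at hn
  obtain ⟨f, a, hf, hne⟩ := hc
  have hcol : ∀ i : Fin 4, ![0, f 2 - f 1, f 3 - f 1, f 4 - f 1] i = f (i + 1) - f 1 := by
    intro i; fin_cases i <;> simp
  have h3 := coloring_four i j k m hne' (f 2 - f 1) (f 3 - f 1) (f 4 - f 1)
  simp only [hcol] at h3
  simp only [Path, Step, if_true, Bool.false_eq_true, if_false] at hf
  obtain ⟨z1, ⟨ha, e1⟩, z2, h4, z3, ⟨e2, e3⟩, z4, h5, z5, ⟨e4, e5⟩, z6, h6, z7, ⟨e6, e7⟩, z8, h7, e8⟩ := hf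
  rw [e1, e2] at h4
  rw [e3, e4] at h5
  rw [e5, e6] at h6
  rw [e7, e8] at h7
  rcases h3 ⟨by simp; linear_combination h4, by simp; linear_combination h5,
    by simp; linear_combination h6, by simp; linear_combination h7 - ha⟩ with
    h7 | ⟨rfl, rfl, rfl, rfl⟩ | ⟨rfl, rfl, rfl, rfl⟩
  · exfalso
    obtain ⟨l, hl, hne⟩ := hne
    apply hne
    have h8 : ∀ i : Fin 4, f (i + 1) = a := by
      intro i
      have := hcol i
      rw [h7.1, h7.2.1, h7.2.2] at this
      rw [ha]
      fin_cases i <;> simp at this ⊢ <;> linear_combination -this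
    have h81 := h8 0
    have h82 := h8 1
    have h83 := h8 2
    have h84 := h8 3
    simp at h81 h82 h83 h84
    simp at hl
    rcases hl with rfl | rfl | rfl | rfl | rfl | rfl | rfl | rfl <;>
      first | exact h8 _ | assumption
  · exact knot_of_word4 h
  · exact knot_of_word4' h

theorem IsGaussCode.crossing_injective_of_upper {w : List Letter} (hw : IsGaussCode w)
    {l l' : Letter} (hl : l ∈ w) (hl' : l' ∈ w) (hu : l.upper = l'.upper)
    (h : l.crossing = l'.crossing) : l = l' := by
  rcases hw.2.2 l hl l' hl' h with h | h
  · exact h.symm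
  · rw [h] at hu
    simp [Letter.flip] at hu

theorem injective_vec3 {α : Type*} {a b c : α} (h1 : a ≠ b) (h2 : a ≠ c) (h3 : b ≠ c) :
    Function.Injective ![a, b, c] := by
  intro i j hij
  fin_cases i <;> fin_cases j <;> first | rfl | (simp at hij; grind)

theorem injective_vec4 {α : Type*} {a b c d : α} (h1 : a ≠ b) (h2 : a ≠ c) (h3 : a ≠ d)
    (h4 : b ≠ c) (h5 : b ≠ d) (h6 : c ≠ d) : Function.Injective ![a, b, c, d] := by
  intro i j hij
  fin_cases i <;> fin_cases j <;> first | rfl | (simp at hij; grind)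

/-- Starting at an overpassage and naming the overpassages `1`, `2`, `3` in the order of travel
brings the word into the form of `knot_of_three`. -/
theorem KnotDiagram.knot_of_alternating_three {D : KnotDiagram} (hD : IsAlternating D.word)
    (hn : numCrossings D.word = 3) (hc : ClosedColoring (ZMod 3) D.word) :
    D.knot = trefoil true ∨ D.knot = trefoil false := by
  obtain ⟨D₁, h1, h2, h3, h4⟩ := D.exists_upper_head hD
  rw [← KnotDiagram.closedColoring_iff h2] at hc
  rw [← numCrossings_perm h3] at hn
  rw [← h2]
  have hlen := h1.length
  have halt := h1.getElem_succ
  rw [hn] at hlen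
  rcases hw : D₁.word with _ | ⟨a, _ | ⟨b, _ | ⟨c, _ | ⟨d, _ | ⟨e, _ | ⟨f, _ | ⟨g, w⟩⟩⟩⟩⟩⟩⟩ <;>
    simp only [hw, List.length_cons, List.length_nil] at hlen <;> try omega
  simp only [hw, List.length_cons, List.length_nil] at halt
  obtain ⟨a, ua, sa⟩ := a
  obtain ⟨b, ub, sb⟩ := b
  obtain ⟨c, uc, sc⟩ := c
  obtain ⟨d, ud, sd⟩ := d
  obtain ⟨e, ue, se⟩ := e
  obtain ⟨f, uf, sf⟩ := f
  have e1 := h4 ⟨a, ua, sa⟩ (by simp [hw])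
  have e2 := halt 0 (by omega)
  have e3 := halt 1 (by omega)
  have e4 := halt 2 (by omega)
  have e5 := halt 3 (by omega)
  have e6 := halt 4 (by omega)
  simp at e1 e2 e3 e4 e5 e6
  subst e1
  simp at e2; subst e2
  simp at e3; subst e3
  simp at e4; subst e4
  simp at e5; subst e5
  simp at e6; subst e6
  have hg := D₁.isGaussCode
  have hinj : Function.Injective ![a, c, e] := by
    have hup := fun {l l'} => hg.crossing_injective_of_upper (l := l) (l' := l')
    have hnd := hg.1
    rw [hw] at hup hnd
    have h1 : a ≠ c := fun h => by
      have := hup (l := ⟨a, true, sa⟩) (l' := ⟨c, true, sc⟩) (by simp) (by simp) rfl h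
      simp [this] at hnd
    have h2 : a ≠ e := fun h => by
      have := hup (l := ⟨a, true, sa⟩) (l' := ⟨e, true, se⟩) (by simp) (by simp) rfl h
      simp [this] at hnd
    have h3 : c ≠ e := fun h => by
      have := hup (l := ⟨c, true, sc⟩) (l' := ⟨e, true, se⟩) (by simp) (by simp) rfl h
      simp [this] at hnd
    exact injective_vec3 h1 h2 h3
  obtain ⟨g, hg⟩ := exists_perm_fin ![a, c, e] ![1, 2, 3] hinj (by decide)
  have g1 : g a = 1 := hg 0
  have g2 : g c = 2 := hg 1
  have g3 : g e = 3 := hg 2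
  obtain ⟨D₂, h5, h6⟩ := D₁.exists_relabel g
  rw [← KnotDiagram.closedColoring_iff h6] at hc
  rw [← h6]
  rw [hw] at h5
  simp only [List.map_cons, List.map_nil, Letter.relabel, g1, g2, g3] at h5
  exact knot_of_three h5 hc

theorem KnotDiagram.knot_of_alternating_four {D : KnotDiagram} (hD : IsAlternating D.word)
    (hn : numCrossings D.word = 4) (hc : ClosedColoring (ZMod 5) D.word) :
    D.knot = figureEight := by
  obtain ⟨D₁, h1, h2, h3, h4⟩ := D.exists_upper_head hD
  rw [← KnotDiagram.closedColoring_iff h2] at hc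
  rw [← numCrossings_perm h3] at hn
  rw [← h2]
  have hlen := h1.length
  have halt := h1.getElem_succ
  rw [hn] at hlen
  rcases hw : D₁.word with _ | ⟨a, _ | ⟨b, _ | ⟨c, _ | ⟨d, _ | ⟨e, _ | ⟨f, _ | ⟨g, _ |
    ⟨h, _ | ⟨i, w⟩⟩⟩⟩⟩⟩⟩⟩⟩ <;>
    simp only [hw, List.length_cons, List.length_nil] at hlen <;> try omega
  simp only [hw, List.length_cons, List.length_nil] at halt
  obtain ⟨a, ua, sa⟩ := a
  obtain ⟨b, ub, sb⟩ := b
  obtain ⟨c, uc, sc⟩ := c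
  obtain ⟨d, ud, sd⟩ := d
  obtain ⟨e, ue, se⟩ := e
  obtain ⟨f, uf, sf⟩ := f
  obtain ⟨k, uk, sk⟩ := g
  obtain ⟨m, um, sm⟩ := h
  have e1 := h4 ⟨a, ua, sa⟩ (by simp [hw])
  have e2 := halt 0 (by omega)
  have e3 := halt 1 (by omega)
  have e4 := halt 2 (by omega)
  have e5 := halt 3 (by omega)
  have e6 := halt 4 (by omega)
  have e7 := halt 5 (by omega)
  have e8 := halt 6 (by omega)
  simp at e1 e2 e3 e4 e5 e6 e7 e8
  subst e1
  simp at e2; subst e2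
  simp at e3; subst e3
  simp at e4; subst e4
  simp at e5; subst e5
  simp at e6; subst e6
  simp at e7; subst e7
  simp at e8; subst e8
  have hg := D₁.isGaussCode
  have hinj : Function.Injective ![a, c, e, k] := by
    have hup := fun {l l'} => hg.crossing_injective_of_upper (l := l) (l' := l')
    have hnd := hg.1
    rw [hw] at hup hnd
    have h1 : a ≠ c := fun h => by
      have := hup (l := ⟨a, true, sa⟩) (l' := ⟨c, true, sc⟩) (by simp) (by simp) rfl h
      simp [this] at hnd
    have h2 : a ≠ e := fun h => by
      have := hup (l := ⟨a, true, sa⟩) (l' := ⟨e, true, se⟩) (by simp) (by simp) rfl h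
      simp [this] at hnd
    have h3 : c ≠ e := fun h => by
      have := hup (l := ⟨c, true, sc⟩) (l' := ⟨e, true, se⟩) (by simp) (by simp) rfl h
      simp [this] at hnd
    have h4 : a ≠ k := fun h => by
      have := hup (l := ⟨a, true, sa⟩) (l' := ⟨k, true, sk⟩) (by simp) (by simp) rfl h
      simp [this] at hnd
    have h5 : c ≠ k := fun h => by
      have := hup (l := ⟨c, true, sc⟩) (l' := ⟨k, true, sk⟩) (by simp) (by simp) rfl h
      simp [this] at hnd
    have h6 : e ≠ k := fun h => by
      have := hup (l := ⟨e, true, se⟩) (l' := ⟨k, true, sk⟩) (by simp) (by simp) rfl h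
      simp [this] at hnd
    exact injective_vec4 h1 h2 h4 h3 h5 h6
  obtain ⟨g, hg⟩ := exists_perm_fin ![a, c, e, k] ![1, 2, 3, 4] hinj (by decide)
  have g1 : g a = 1 := hg 0
  have g2 : g c = 2 := hg 1
  have g3 : g e = 3 := hg 2
  have g4 : g k = 4 := hg 3
  obtain ⟨D₂, h5, h6⟩ := D₁.exists_relabel g
  rw [← KnotDiagram.closedColoring_iff h6] at hc
  rw [← h6]
  rw [hw] at h5
  simp only [List.map_cons, List.map_nil, Letter.relabel, g1, g2, g3, g4] at h5
  exact knot_of_four h5 hc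

/-! ### Crossing numbers and the conclusion. -/

theorem Knot.exists_minimal_diagram (K : Knot) :
    ∃ D : KnotDiagram, D.knot = K ∧ numCrossings D.word = K.crossingNumber := by
  refine Nat.sInf_mem (s := {n | ∃ D : KnotDiagram, D.knot = K ∧ numCrossings D.word = n}) ?_
  obtain ⟨D, rfl⟩ := Quot.exists_rep K
  exact ⟨_, D, rfl, rfl⟩

theorem KnotDiagram.crossingNumber_le (D : KnotDiagram) :
    D.knot.crossingNumber ≤ numCrossings D.word :=
  Nat.sInf_le ⟨D, rfl, rfl⟩

theorem crossingNumber_trefoil_le (s : Bool) : (trefoil s).crossingNumber ≤ 3 :=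
  (KnotDiagram.crossingNumber_le _).trans (by revert s; decide)

theorem crossingNumber_figureEight_le : figureEight.crossingNumber ≤ 4 :=
  (KnotDiagram.crossingNumber_le _).trans (by decide)

/-- The crossing number of a colorable knot, apart from the trefoil knots and the figure-eight
knot. -/
theorem Knot.IsColorable.cases {p : ℕ} (hp : p.Prime) (hodd : p ≠ 2) {K : Knot}
    (hK : K.IsColorable p) :
    (p = 3 ∧ K.crossingNumber = 3 ∧ (K = trefoil true ∨ K = trefoil false)) ∨
      (p = 5 ∧ K.crossingNumber = 4 ∧ K = figureEight) ∨
      Nat.log 2 p + 2 < K.crossingNumber := by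
  obtain ⟨D₀, rfl, h₀⟩ := hK
  obtain ⟨D, hD, hn⟩ := D₀.knot.exists_minimal_diagram
  have hc := (KnotDiagram.closedColoring_iff hD).2 h₀.closedColoring
  rw [← hD] at hn ⊢
  rw [← hn]
  have h2 := hp.two_le
  rcases D.small_or_lt_two_pow hp hodd hc with ⟨halt, ⟨h3, rfl⟩ | ⟨h4, h5⟩⟩ | h
  · exact Or.inl ⟨rfl, h3, D.knot_of_alternating_three halt h3 hc⟩
  · obtain rfl | rfl : p = 3 ∨ p = 5 := by
      interval_cases p
      · exact absurd rfl hodd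
      · exact Or.inl rfl
      · exact absurd hp (by norm_num)
      · exact Or.inr rfl
    -- Four crossings with `p = 3` are no equality case, as `Nat.log 2 3 + 2 = 3`.
    · right; right
      rw [h4]
      norm_num [Nat.log]
    · exact Or.inr (Or.inl ⟨rfl, h4, D.knot_of_alternating_four halt h4 hc⟩)
  · right; right
    have := Nat.log_lt_of_lt_pow (by omega) h
    omega

end KnotTheory

theorem mainTheorem5 (p : ℕ) (hp : p.Prime) (hodd : p ≠ 2)
    (K : KnotTheory.Knot) (hK : K.IsColorable p) :
    ⌊Real.logb 2 (p : ℝ)⌋ + 2 ≤ (K.crossingNumber : ℤ) ∧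
      ((K.crossingNumber : ℤ) = ⌊Real.logb 2 (p : ℝ)⌋ + 2 ↔
        (p = 3 ∧ (K = KnotTheory.trefoil true ∨ K = KnotTheory.trefoil false)) ∨
          (p = 5 ∧ K = KnotTheory.figureEight)) := by
  have hlog : ⌊Real.logb 2 (p : ℝ)⌋ = (Nat.log 2 p : ℤ) := by
    have := Real.floor_logb_natCast (b := 2) (r := (p : ℝ)) (by positivity)
    rw [Int.log_natCast] at this
    exact_mod_cast this
  have hlog3 : Nat.log 2 3 = 1 := by norm_num [Nat.log]
  have hlog5 : Nat.log 2 5 = 2 := by norm_num [Nat.log]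
  rw [hlog]
  rcases hK.cases hp hodd with ⟨rfl, h, hK'⟩ | ⟨rfl, h, hK'⟩ | h
  · rw [h, hlog3]
    exact ⟨by norm_num, by simp [hK']⟩
  · rw [h, hlog5]
    exact ⟨by norm_num, by simp [hK']⟩
  -- The inequality is strict here, so `K` is none of the listed knots: their standard diagrams have
  -- only `Nat.log 2 p + 2` crossings.
  · refine ⟨by omega, ⟨fun h' => by omega, ?_⟩⟩
    rintro (⟨rfl, rfl | rfl⟩ | ⟨rfl, rfl⟩)
    · have := KnotTheory.crossingNumber_trefoil_le true
      omega
    · have := KnotTheory.crossingNumber_trefoil_le false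
      omega
    · have := KnotTheory.crossingNumber_figureEight_le
      omega
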